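/- Let $V$ be an $r$-dimensional real vector space, fix a scalar product $(\cdot,\cdot)$ on $V^*$, and let $\mathfrak A=[\alpha_1,\dots,\alpha_n]$ be a list of (not necessarily distinct) non-zero vectors of $V^*$, viewed as linear functions on $V$. Let $\Lambda$ be a connected component of $V\setminus\bigcup_i\{\alpha_i=0\}$ and suppose that all $\alpha_i$ are polarized, i.e. $\alpha_i(v)>0$ for all $v\in\Lambda$. Let $\varepsilon\in V^*$ be regular, i.e. $\varepsilon$ lies on no subspace of $V^*$ of dimension at most $r-1$ spanned by a subset of $\mathfrak A$. Let $J\subset\{1,\dots,n\}$ be such that $(\alpha_j)_{j\in J}$ is a basis of $V^*$ and $\varepsilon\in\mathrm{Cone}(\alpha_j\mid j\in J)$, where $\mathrm{Cone}$ denotes the set of linear combinations with non-negative coefficients. *Iterated residue.* Let $\xi\in\Lambda$ and let $x_1,\dots,x_r$ be a basis of $V^*$ with $x_1(\xi)=1$, $x_2(\xi)=\dots=x_r(\xi)=0$. For a rational function $f$ whose denominator is a product of linear forms and a linear form $\mu=\sum_k\mu_kx_k$, let $\mathrm{Res}^+_{x_k}(f e^{\mu})$ be $0$ if $\mu_k<0$,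 and if $\mu_k\ge 0$ let it be the residue $\frac{1}{2\pi i}\oint f e^{\mu}\,dx_k$ over a large counterclockwise circle in the $x_k$-plane, the other coordinates being constant; that is, the sum of the residues at all finite poles in $x_k$. It is again a finite sum of terms $f'e^{\mu'}$, and $\mathrm{Res}^+$ is extended additively to such sums. For a polynomial $P\in\mathbb R[V]$ put $$\mathrm{JKRes}^{\Lambda}\frac{P e^{\varepsilon}}{\prod_{i=1}^n\alpha_i}=\frac{1}{\sqrt{\det[(x_i,x_j)]_{i,j=1}^r}}\,\mathrm{Res}^+_{x_r}\Big(\cdots\Big(\mathrm{Res}^+_{x_1}\frac{P e^{\varepsilon}}{\prod_{i=1}^n\alpha_i}\Big)\cdots\Big).$$ *The functional $\mathrm{JK}_\varepsilon$.* Let $R_{\mathfrak A}$ be the space of rational functions $P/\prod_i\alpha_i^{m_i}$ with $P\in\mathbb R[V]$, $m_i\ge0$. Let $\mathrm{JK}_\varepsilon:R_{\mathfrak A}\to\mathbb R$ be the linear functional that vanishes on all $P/\prod_i\alpha_i^{m_i}$ for which $\{\alpha_i\mid m_i>0\}$ does not span $V^*$, vanishes on all $1/\prod_i\alpha_i^{m_i}$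 for which $\{\alpha_i\mid m_i>0\}$ spans $V^*$ and $\sum_i m_i\ne r$, and satisfies, for every basis $\alpha_{i_1},\dots,\alpha_{i_r}$ of $V^*$, $$\mathrm{JK}_\varepsilon\Big(\frac1{\alpha_{i_1}\cdots\alpha_{i_r}}\Big)=\begin{cases}\dfrac{1}{\sqrt{\det[(\alpha_{i_k},\alpha_{i_l})]_{k,l=1}^r}}&\text{if }\varepsilon\in\mathrm{Cone}(\alpha_{i_1},\dots,\alpha_{i_r}),\\[2mm]0&\text{otherwise.}\end{cases}$$ *Normal forms.* Let $\mathcal I_{\mathfrak A,\varepsilon}\subset\mathbb R[V]$ be the ideal generated by the products $\prod_{j\in K}\alpha_j$ over all $K\subset\{1,\dots,n\}$ with $\varepsilon\notin\mathrm{Cone}(\alpha_i\mid i\notin K)$. Identify $\mathbb R[V]$ with a polynomial ring by any basis of $V^*$ and fix any monomial order; let $N_{\mathcal I}(f)$ be the normal form of $f$ with respect to an ideal $\mathcal I$, i.e. the unique polynomial such that $f-N_{\mathcal I}(f)\in\mathcal I$ and no monomial of $N_{\mathcal I}(f)$ lies in the ideal generated by the leading terms of the elements of $\mathcal I$. Then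 $\mathrm{JK}_\varepsilon$ exists and is unique, $N_{\mathcal I_{\mathfrak A,\varepsilon}}\big(\prod_{i\notin J}\alpha_i\big)\neq0$, and for every $P\in\mathbb R[V]$ homogeneous of degree $n-r$ and every choice of $\xi\in\Lambda$ and $x_1,\dots,x_r$ as above, $$\mathrm{JKRes}^{\Lambda}\frac{P e^{\varepsilon}}{\prod_{i=1}^n\alpha_i}=\mathrm{JK}_\varepsilon\Big(\frac{P}{\prod_{i=1}^n\alpha_i}\Big)=\frac{1}{\sqrt{\det[(\alpha_i,\alpha_j)]_{i,j\in J}}}\cdot\frac{N_{\mathcal I_{\mathfrak A,\varepsilon}}(P)}{N_{\mathcal I_{\mathfrak A,\varepsilon}}\big(\prod_{i\notin J}\alpha_i\big)}.$$ -/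

import Mathlib

open scoped NNReal

noncomputable section

namespace JeffreyKirwan

/-! ### Polynomials and rational functions in `r` coordinates -/

/-- Polynomials in `r` coordinates. A basis of `V*` identifies them with `ℝ[V]`. -/
abbrev Poly (r : ℕ) : Type := MvPolynomial (Fin r) ℝ

/-- Rational functions in `r` coordinates. -/
abbrev RatFun (r : ℕ) : Type := FractionRing (Poly r)

/-- The homogeneous linear polynomial with coefficients `c`. -/
def linPoly {r : ℕ} (c : Fin r → ℝ) : Poly r :=
  ∑ k, MvPolynomial.C (c k) * MvPolynomial.X k

section Vectors

variable {V : Type*} [AddCommGroup V] [Module ℝ V]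

/-- An element `β` of `V*` as a polynomial in the coordinates `b` (a basis of `V*`). -/
def linForm {r : ℕ} (b : Module.Basis (Fin r) ℝ (Module.Dual ℝ V)) (β : Module.Dual ℝ V) :
    Poly r :=
  linPoly fun k => b.repr β k

/-- Rewriting a polynomial function on `V` from the coordinates `y` to the coordinates `x`. -/
def changeCoord {r : ℕ} (y x : Module.Basis (Fin r) ℝ (Module.Dual ℝ V)) (P : Poly r) : Poly r :=
  MvPolynomial.aeval (fun i => linForm x (y i)) P

/-! ### Cones, polarization, regularity -/

/-- The closed convex cone generated by `α i`, `i ∈ S`. -/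
def cone {ι : Type*} (α : ι → Module.Dual ℝ V) (S : Set ι) : Set (Module.Dual ℝ V) :=
  (Submodule.span ℝ≥0 (α '' S) : Submodule ℝ≥0 (Module.Dual ℝ V))

/-- The dual cone `Λ^∨` of `Λ`. -/
def dualCone (Λ : Set V) : Set (Module.Dual ℝ V) :=
  {β | ∀ v ∈ Λ, 0 < β v}

/-- The complement of the union of the hyperplanes `α i = 0`. -/
def arrangementCompl {n : ℕ} (α : Fin n → Module.Dual ℝ V) : Set V :=
  {v | ∀ i, α i v ≠ 0}

/-- `Λ` is a connected component of the complement of the hyperplanes `α i = 0`. -/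
def IsComponent [TopologicalSpace V] {n : ℕ} (α : Fin n → Module.Dual ℝ V) (Λ : Set V) : Prop :=
  ∃ v ∈ arrangementCompl α, Λ = connectedComponentIn (arrangementCompl α) v

/-- `ε` lies on no proper subspace of `V*` spanned by a subset of the `α i`. -/
def IsRegular {n : ℕ} (α : Fin n → Module.Dual ℝ V) (ε : Module.Dual ℝ V) : Prop :=
  ∀ S : Set (Fin n),
    Module.finrank ℝ (Submodule.span ℝ (α '' S)) < Module.finrank ℝ (Module.Dual ℝ V) →
      ε ∉ Submodule.span ℝ (α '' S)

/-- The family `β` is a basis of `V*`. -/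
def IsBasisFamily {ι : Type*} (β : ι → Module.Dual ℝ V) : Prop :=
  LinearIndependent ℝ β ∧ Submodule.span ℝ (Set.range β) = ⊤

/-- The Gram determinant of the family `β` with respect to the scalar product `B` on `V*`. -/
def gramDet {ι : Type*} [Fintype ι] [DecidableEq ι]
    (B : LinearMap.BilinForm ℝ (Module.Dual ℝ V)) (β : ι → Module.Dual ℝ V) : ℝ :=
  (Matrix.of fun i j => B (β i) (β j)).det

/-- `B` is a scalar product on `V*`. -/
def IsScalarProduct (B : LinearMap.BilinForm ℝ (Module.Dual ℝ V)) : Prop :=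
  (∀ β γ, B β γ = B γ β) ∧ ∀ β, β ≠ 0 → 0 < B β β

end Vectors

/-! ### The iterated residue

All functions met in the iteration are finite sums `∑ f_μ e^μ` with `μ` a linear form (given by its
coefficients in the coordinates `x`) and `f_μ` a rational function whose denominator is a product
of linear forms. -/

/-- Formal sums `∑ f_μ e^μ` with `f_μ` rational functions and `μ` linear forms. -/
abbrev ExpRat (r : ℕ) : Type := (Fin r → ℝ) →₀ RatFun r

/-- The substitution `x_k ↦ ℓ + T` (the other coordinates stay) into a polynomial,
with values in the polynomials in `T` over the rational functions. -/
def shiftPoly {r : ℕ} (k : Fin r) (l : Fin r → ℝ) : Poly r →ₐ[ℝ] Polynomial (RatFun r) :=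
  MvPolynomial.aeval fun j =>
    if j = k then Polynomial.C (algebraMap (Poly r) (RatFun r) (linPoly l)) + Polynomial.X
    else Polynomial.C (algebraMap (Poly r) (RatFun r) (MvPolynomial.X j))

/-- `shiftPoly`, read in the Laurent series in `T`. -/
def shiftLaurent {r : ℕ} (k : Fin r) (l : Fin r → ℝ) : Poly r →+* LaurentSeries (RatFun r) :=
  ((HahnSeries.ofPowerSeries ℤ (RatFun r)).comp Polynomial.coeToPowerSeries.ringHom).comp
    (shiftPoly k l).toRingHom

theorem shiftPoly_injective {r : ℕ} (k : Fin r) (l : Fin r → ℝ) :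
    Function.Injective (shiftPoly k l) := by
  -- evaluating at `T = x_k - ℓ` gives back the inclusion of polynomials into rational functions
  have key : ∀ p : Poly r,
      Polynomial.aeval (R := RatFun r) (algebraMap (Poly r) (RatFun r) (MvPolynomial.X k) -
        algebraMap (Poly r) (RatFun r) (linPoly l)) (shiftPoly k l p) =
        algebraMap (Poly r) (RatFun r) p := by
    intro p
    induction p using MvPolynomial.induction_on with
    | C a =>
      have h1 : (MvPolynomial.C a : Poly r) = algebraMap ℝ (Poly r) a := rfl
      rw [h1, AlgHom.commutes, ← IsScalarTower.algebraMap_apply ℝ (Poly r) (RatFun r),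
        IsScalarTower.algebraMap_apply ℝ (RatFun r) (Polynomial (RatFun r)),
        Polynomial.algebraMap_eq, Polynomial.aeval_C]
      rfl
    | add p q hp hq => rw [map_add, map_add, map_add, hp, hq]
    | mul_X p j hp =>
      rw [map_mul, map_mul, map_mul, hp]
      congr 1
      by_cases h : j = k
      · subst h
        simp [shiftPoly]
      · simp [shiftPoly, h]
  intro p q hpq
  apply IsFractionRing.injective (Poly r) (RatFun r)
  rw [← key p, ← key q, hpq]

theorem shiftLaurent_injective {r : ℕ} (k : Fin r) (l : Fin r → ℝ) :
    Function.Injective (shiftLaurent k l) := by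
  intro p q hpq
  apply shiftPoly_injective k l
  apply Polynomial.coe_injective (RatFun r)
  exact HahnSeries.ofPowerSeries_injective hpq

/-- The Laurent expansion in `T = x_k - ℓ` of a rational function `f`, in which all coordinates
other than `x_k` are constants. -/
def laurentExpansion {r : ℕ} (k : Fin r) (l : Fin r → ℝ) : RatFun r →+* LaurentSeries (RatFun r) :=
  IsFractionRing.lift (shiftLaurent_injective k l)

/-- The power series of `e^{c T}`. -/
def expSeries {r : ℕ} (c : ℝ) : LaurentSeries (RatFun r) :=
  HahnSeries.ofPowerSeries ℤ (RatFun r)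
    (PowerSeries.mk fun m => algebraMap ℝ (RatFun r) (c ^ m / (m.factorial : ℝ)))

/-- The residue of `f e^{c (x_k - ℓ)} d x_k` at `x_k = ℓ`. -/
def residueAt {r : ℕ} (k : Fin r) (l : Fin r → ℝ) (c : ℝ) (f : RatFun r) : RatFun r :=
  (laurentExpansion k l f * expSeries c).coeff (-1)

/-- The linear form obtained from `μ` by the substitution `x_k ↦ ℓ`, where `ℓ` does not
involve `x_k`. -/
def substForm {r : ℕ} (k : Fin r) (l μ : Fin r → ℝ) : Fin r → ℝ :=
  fun j => if j = k then 0 else μ j + μ k * l j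

/-- The residue of `f e^μ d x_k` at `x_k = ∞`, with the other coordinates constant. It is
`(2πi)⁻¹ ∮ f e^μ d x_k` over a large counterclockwise circle in the `x_k`-plane, that is, the sum
of the residues at the finite poles. The poles of a rational function whose
denominator is a product of linear forms are of the form `x_k = ℓ` with `ℓ` a linear form in the
other coordinates, and only finitely many `ℓ` contribute. As
`e^μ = e^{μ|_{x_k = ℓ}} e^{μ_k (x_k - ℓ)}`, the residue at `x_k = ℓ` is again a rational
function times an exponential. -/
def resInfty {r : ℕ} (k : Fin r) (μ : Fin r → ℝ) (f : RatFun r) : ExpRat r :=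
  ∑ᶠ (l : Fin r → ℝ) (_ : l k = 0), Finsupp.single (substForm k l μ) (residueAt k l (μ k) f)

/-- `Res⁺_{x_k}`: on `f e^μ` it is the residue at `x_k = ∞` if the coefficient of `x_k` in `μ`
is nonnegative, and `0` otherwise; extended to sums of such terms. -/
def resPlus {r : ℕ} (k : Fin r) (h : ExpRat r) : ExpRat r :=
  h.sum fun μ f => if 0 ≤ μ k then resInfty k μ f else 0

/-- `Res⁺_{x_r} (⋯ (Res⁺_{x_1} h))`, the residue in the first coordinate being taken first. -/
def iteratedRes {r : ℕ} (h : ExpRat r) : ExpRat r :=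
  (List.finRange r).foldl (fun g k => resPlus k g) h

/-- The real constant `c` as a formal sum, `c e^0`. -/
def constExpRat {r : ℕ} (c : ℝ) : ExpRat r :=
  Finsupp.single 0 (algebraMap ℝ (RatFun r) c)

section Residue

variable {V : Type*} [AddCommGroup V] [Module ℝ V] {n r : ℕ}

/-- The Jeffrey-Kirwan residue `JKRes^Λ (P e^ε / ∏ α_i)` computed by iterated residues in the
coordinates `x`. The polynomial function `P` on `V` is given in the coordinates `y`. -/
def JKRes (B : LinearMap.BilinForm ℝ (Module.Dual ℝ V))
    (y x : Module.Basis (Fin r) ℝ (Module.Dual ℝ V)) (α : Fin n → Module.Dual ℝ V)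
    (ε : Module.Dual ℝ V) (P : Poly r) : ExpRat r :=
  (1 / Real.sqrt (gramDet B fun k => x k)) •
    iteratedRes (Finsupp.single (fun k => x.repr ε k)
      (algebraMap (Poly r) (RatFun r) (changeCoord y x P) /
        ∏ i, algebraMap (Poly r) (RatFun r) (linForm x (α i))))

/-- `x` is adapted to `ξ`: `x_1(ξ) = 1` and `x_2(ξ) = ⋯ = x_r(ξ) = 0`. -/
def IsAdapted (x : Module.Basis (Fin r) ℝ (Module.Dual ℝ V)) (ξ : V) : Prop :=
  ∀ k : Fin r, x k ξ = if (k : ℕ) = 0 then 1 else 0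

/-! ### The functional `JK_ε` -/

/-- The fraction `P / ∏ α_i ^ m_i`, in the coordinates `y`. -/
def frac (y : Module.Basis (Fin r) ℝ (Module.Dual ℝ V)) (α : Fin n → Module.Dual ℝ V)
    (P : Poly r) (m : Fin n → ℕ) : RatFun r :=
  algebraMap (Poly r) (RatFun r) P / ∏ i, algebraMap (Poly r) (RatFun r) (linForm y (α i)) ^ m i

/-- The vector space `R_𝔄` of rational functions of the form `P / ∏ α_i ^ m_i`. -/
def ratSpace (y : Module.Basis (Fin r) ℝ (Module.Dual ℝ V)) (α : Fin n → Module.Dual ℝ V) :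
    Submodule ℝ (RatFun r) :=
  Submodule.span ℝ {f | ∃ (P : Poly r) (m : Fin n → ℕ), f = frac y α P m}

theorem frac_mem_ratSpace (y : Module.Basis (Fin r) ℝ (Module.Dual ℝ V))
    (α : Fin n → Module.Dual ℝ V) (P : Poly r) (m : Fin n → ℕ) :
    frac y α P m ∈ ratSpace y α :=
  Submodule.subset_span ⟨P, m, rfl⟩

/-- The fraction `P / ∏ α_i` as an element of `R_𝔄`. -/
def simpleFrac (y : Module.Basis (Fin r) ℝ (Module.Dual ℝ V)) (α : Fin n → Module.Dual ℝ V)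
    (P : Poly r) : ratSpace y α :=
  ⟨frac y α P fun _ => 1, frac_mem_ratSpace y α P _⟩

/-- `S` is generating: the `α i` with `i ∈ S` span `V*`. -/
def IsGenerating (α : Fin n → Module.Dual ℝ V) (S : Set (Fin n)) : Prop :=
  Submodule.span ℝ (α '' S) = ⊤

/-- The part of degree `-d` of `G_𝔄`: the span of the `1 / ∏ α_i ^ m_i` with generating
`{i | m_i > 0}` and `∑ m_i = d`. -/
def genPart (y : Module.Basis (Fin r) ℝ (Module.Dual ℝ V)) (α : Fin n → Module.Dual ℝ V) (d : ℕ) :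
    Submodule ℝ (RatFun r) :=
  Submodule.span ℝ {f | ∃ m : Fin n → ℕ,
    IsGenerating α {i | 0 < m i} ∧ ∑ i, m i = d ∧ f = frac y α 1 m}

/-- `NG_𝔄`: the span of the `P / ∏ α_i ^ m_i` with non-generating `{i | m_i > 0}`. -/
def nonGenPart (y : Module.Basis (Fin r) ℝ (Module.Dual ℝ V)) (α : Fin n → Module.Dual ℝ V) :
    Submodule ℝ (RatFun r) :=
  Submodule.span ℝ {f | ∃ (P : Poly r) (m : Fin n → ℕ),
    ¬ IsGenerating α {i | 0 < m i} ∧ f = frac y α P m}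

open scoped Classical in
/-- The defining properties of the linear functional `JK_ε` on `R_𝔄`: it vanishes on `NG_𝔄` and
on the parts of `G_𝔄` of degree other than `-r`, and `1 / (α_{i_1} ⋯ α_{i_r})` for a basis
`α_{i_1}, …, α_{i_r}` of `V*` has the prescribed value. -/
structure IsJKFunctional (B : LinearMap.BilinForm ℝ (Module.Dual ℝ V))
    (y : Module.Basis (Fin r) ℝ (Module.Dual ℝ V)) (α : Fin n → Module.Dual ℝ V)
    (ε : Module.Dual ℝ V) (L : ratSpace y α →ₗ[ℝ] ℝ) : Prop where
  nonGen : ∀ f : ratSpace y α, (f : RatFun r) ∈ nonGenPart y α → L f = 0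
  gen_of_ne : ∀ d : ℕ, d ≠ r → ∀ f : ratSpace y α, (f : RatFun r) ∈ genPart y α d → L f = 0
  basis : ∀ s : Fin r → Fin n, IsBasisFamily (fun k => α (s k)) → ∀ f : ratSpace y α,
    (f : RatFun r) = 1 / ∏ k, algebraMap (Poly r) (RatFun r) (linForm y (α (s k))) →
      L f = if ε ∈ cone α (Set.range s) then 1 / Real.sqrt (gramDet B fun k => α (s k)) else 0

/-! ### The ideal and normal forms -/

/-- The ideal generated by the `∏_{j ∈ J} α_j` with `ε ∉ Cone(α_i | i ∉ J)`,
in the coordinates `y`. -/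
def jkIdeal (y : Module.Basis (Fin r) ℝ (Module.Dual ℝ V)) (α : Fin n → Module.Dual ℝ V)
    (ε : Module.Dual ℝ V) : Ideal (Poly r) :=
  Ideal.span {q | ∃ J : Finset (Fin n),
    ε ∉ cone α {i | i ∉ J} ∧ q = ∏ j ∈ J, linForm y (α j)}

end Residue

/-- The ideal generated by the leading terms of the elements of `I`. -/
def leadingIdeal {r : ℕ} (mo : MonomialOrder (Fin r)) (I : Ideal (Poly r)) : Ideal (Poly r) :=
  Ideal.span {q | ∃ f ∈ I, q = mo.leadingTerm f}

/-- `N` is a normal form of `f`: `f - N ∈ I` and no monomial of `N` is in the ideal of leading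
terms of `I`. -/
def IsNormalForm {r : ℕ} (mo : MonomialOrder (Fin r)) (I : Ideal (Poly r)) (f N : Poly r) : Prop :=
  f - N ∈ I ∧ ∀ a ∈ N.support, MvPolynomial.monomial a (1 : ℝ) ∉ leadingIdeal mo I

theorem monomial_mem_leadingIdeal {r : ℕ} (mo : MonomialOrder (Fin r)) (I : Ideal (Poly r))
    {f : Poly r} (hf : f ∈ I) (h0 : f ≠ 0) :
    MvPolynomial.monomial (mo.degree f) (1 : ℝ) ∈ leadingIdeal mo I := by
  have h1 : mo.leadingCoeff f ≠ 0 := mo.leadingCoeff_ne_zero_iff.mpr h0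
  have h2 : MvPolynomial.monomial (mo.degree f) (1 : ℝ) =
      MvPolynomial.C (mo.leadingCoeff f)⁻¹ * mo.leadingTerm f := by
    rw [MonomialOrder.leadingTerm, MvPolynomial.C_mul_monomial, inv_mul_cancel₀ h1]
  rw [h2]
  exact Ideal.mul_mem_left _ _ (Ideal.subset_span ⟨f, hf, rfl⟩)

theorem existsUnique_isNormalForm {r : ℕ} (mo : MonomialOrder (Fin r)) (I : Ideal (Poly r))
    (f : Poly r) : ∃! N : Poly r, IsNormalForm mo I f N := by
  obtain ⟨g, N, hfN, -, hN⟩ := mo.div_set (B := {b | b ∈ I ∧ b ≠ 0})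
    (fun b hb => (mo.leadingCoeff_ne_zero_iff.mpr hb.2).isUnit) f
  refine ⟨N, ⟨?_, ?_⟩, ?_⟩
  · rw [hfN, add_sub_cancel_right, Finsupp.linearCombination_apply]
    exact Ideal.sum_mem _ fun b _ => Ideal.mul_mem_left _ _ b.2.1
  · intro a ha hmem
    have hle : leadingIdeal mo I ≤ Ideal.span
        ((fun s => MvPolynomial.monomial s (1 : ℝ)) '' {d | ∃ b ∈ I, b ≠ 0 ∧ mo.degree b = d}) := by
      refine Ideal.span_le.mpr ?_
      rintro q ⟨b, hb, rfl⟩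
      by_cases h0 : b = 0
      · simp [h0]
      · have h2 : mo.leadingTerm b = MvPolynomial.C (mo.leadingCoeff b) *
            MvPolynomial.monomial (mo.degree b) (1 : ℝ) := by
          rw [MonomialOrder.leadingTerm, MvPolynomial.C_mul_monomial, mul_one]
        rw [h2]
        exact Ideal.mul_mem_left _ _ (Ideal.subset_span ⟨_, ⟨b, hb, h0, rfl⟩, rfl⟩)
    obtain ⟨d, ⟨b, hb, h0, rfl⟩, hd⟩ := MvPolynomial.mem_ideal_span_monomial_image.mp (hle hmem) a
      (by simp)
    exact hN a ha b ⟨hb, h0⟩ hd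
  · rintro M ⟨hM1, hM2⟩
    by_contra hne
    have hd0 : M - N ≠ 0 := sub_ne_zero.mpr hne
    have hNmem : f - N ∈ I := by
      rw [hfN, add_sub_cancel_right, Finsupp.linearCombination_apply]
      exact Ideal.sum_mem _ fun b _ => Ideal.mul_mem_left _ _ b.2.1
    have hdI : M - N ∈ I := by
      have h := I.sub_mem hNmem hM1
      rwa [sub_sub_sub_cancel_left] at h
    have hs := mo.degree_mem_support hd0
    rcases Finset.mem_union.mp (MvPolynomial.support_sub _ M N hs) with h | h
    · exact hM2 _ h (monomial_mem_leadingIdeal mo I hdI hd0)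
    · exact hN _ h _ ⟨hdI, hd0⟩ le_rfl

/-- The normal form of `f` with respect to `I` and the monomial order `mo`. -/
def normalForm {r : ℕ} (mo : MonomialOrder (Fin r)) (I : Ideal (Poly r)) (f : Poly r) : Poly r :=
  (existsUnique_isNormalForm mo I f).choose

theorem isNormalForm_normalForm {r : ℕ} (mo : MonomialOrder (Fin r)) (I : Ideal (Poly r))
    (f : Poly r) : IsNormalForm mo I f (normalForm mo I f) :=
  (existsUnique_isNormalForm mo I f).choose_spec.1

end JeffreyKirwan

end

open JeffreyKirwan

/-! Modulo fractions with non-spanning denominators, partial fractions (`frac_one_mem`,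
`frac_monomial_mem`) reduce every element of `R_𝔄` to fractions `1 / ∏ α_i ^ m_i` supported on a
basis, and for homogeneous numerators they preserve the total degree. In degree `-r` only simple
fractions over bases remain. Hence `JK_ε` is unique, and the residue formula has to be checked only
on non-spanning fractions and on simple fractions over bases.

On a non-spanning fraction the iterated residue vanishes (`resFold_eq_zero`): taking a residue
translates the exponent along one of the poles, so its class modulo the span `W` of the poles never
changes. It would have to end at `0`, whereas the regular `ε` is not in `W`. For a basis `β` with `ε
= ∑ c_i β_i`, the iterated residue of `e^ε / ∏ β_i` is `|det β|⁻¹ ∏ lexWeight (β_i) (c_i)`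
(`resFold_basis`). Signed weights are needed because substituting a pole can turn positive forms
into negative ones; the induction step is a telescoping sum along the lexicographic order
(`sum_prod_erase_sub`, `sum_lexWeight`). In adapted coordinates the `x_1`-coefficient of `α_i` is
`α_i(ξ) > 0`, so initially every weight is the indicator of `c_i > 0` and the product detects `ε ∈
Cone(β)`. The iterated residue makes sense on all rational functions, so composed with the
projection to degree `-r` it also proves that `JK_ε` exists.

For the normal forms, `P ↦ JK_ε(P / ∏ α_i)` kills the ideal (`apply_simpleFrac_of_mem`), and modulo
the ideal every form of degree `n - r` is a multiple of `∏_{i ∉ J} α_i`. Indeed such a form reduces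
to products `∏_{i ∉ S} α_i` over bases `S` with `ε ∈ Cone(S)` (`monomial_mul_coProd_mem`), and a
simplex-method argument carries each `S` to `J` by exchanges that decrease a linear cost
(`coProd_mem_sup_span`). If `P ≡ c ∏_{i ∉ J} α_i`, then both `JK_ε` and the normal form of `P` are
`c` times those of the product; the latter is not in the ideal because `JK_ε` does not kill it. -/

noncomputable section

namespace JeffreyKirwan

/-! ### Linear forms as rational functions -/

section LinearForms

variable {r : ℕ}

/-- The linear form with coefficients `a`, as a rational function. -/
def linRat : (Fin r → ℝ) →ₗ[ℝ] RatFun r where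
  toFun a := algebraMap (Poly r) (RatFun r) (linPoly a)
  map_add' a b := by
    simp only [linPoly, Pi.add_apply, map_add, add_mul, Finset.sum_add_distrib]
  map_smul' t a := by
    rw [RingHom.id_apply, Algebra.smul_def (A := RatFun r),
      IsScalarTower.algebraMap_apply ℝ (Poly r) (RatFun r), ← map_mul]
    congr 1
    simp only [linPoly, Pi.smul_apply, smul_eq_mul, Finset.mul_sum, MvPolynomial.algebraMap_eq,
      map_mul, mul_assoc]

theorem linRat_apply (a : Fin r → ℝ) :
    linRat a = algebraMap (Poly r) (RatFun r) (linPoly a) := rfl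

theorem coeff_linPoly (a : Fin r → ℝ) (k : Fin r) :
    MvPolynomial.coeff (Finsupp.single k 1) (linPoly a) = a k := by
  classical
  simp only [linPoly, MvPolynomial.coeff_sum, MvPolynomial.coeff_C_mul, MvPolynomial.coeff_X,
    Finsupp.single_left_inj one_ne_zero, Finset.sum_ite_eq', mul_ite, mul_one, mul_zero,
    Finset.mem_univ, if_true]

theorem linPoly_injective : Function.Injective (linPoly (r := r)) := by
  intro a b h
  ext k
  rw [← coeff_linPoly a k, h, coeff_linPoly]

theorem linRat_injective : Function.Injective (linRat (r := r)) := fun _ _ h =>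
  linPoly_injective (IsFractionRing.injective (Poly r) (RatFun r) h)

theorem linRat_eq_zero_iff {a : Fin r → ℝ} : linRat a = 0 ↔ a = 0 :=
  map_eq_zero_iff _ linRat_injective

theorem isHomogeneous_linPoly (a : Fin r → ℝ) : (linPoly a).IsHomogeneous 1 :=
  MvPolynomial.IsHomogeneous.sum _ _ _ fun k _ => by
    simpa using (MvPolynomial.isHomogeneous_C (Fin r) (a k)).mul (MvPolynomial.isHomogeneous_X ℝ k)

theorem linPoly_single (k : Fin r) : linPoly (Pi.single k 1) = (MvPolynomial.X k : Poly r) := by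
  rw [linPoly, Finset.sum_eq_single k]
  · simp
  · intro j _ hj
    simp [hj]
  · simp

/-! ### Laurent expansions -/

theorem laurentExpansion_algebraMap (k : Fin r) (l : Fin r → ℝ) (p : Poly r) :
    laurentExpansion k l (algebraMap (Poly r) (RatFun r) p) = shiftLaurent k l p :=
  IsFractionRing.lift_algebraMap _ _

theorem shiftLaurent_apply (k : Fin r) (l : Fin r → ℝ) (p : Poly r) :
    shiftLaurent k l p =
      HahnSeries.ofPowerSeries ℤ (RatFun r) (shiftPoly k l p : PowerSeries (RatFun r)) := rfl

theorem laurentExpansion_real (k : Fin r) (l : Fin r → ℝ) (c : ℝ) :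
    laurentExpansion k l (algebraMap ℝ (RatFun r) c) =
      HahnSeries.ofPowerSeries ℤ (RatFun r) (PowerSeries.C (algebraMap ℝ (RatFun r) c)) := by
  rw [IsScalarTower.algebraMap_apply ℝ (Poly r) (RatFun r), laurentExpansion_algebraMap,
    shiftLaurent_apply, AlgHom.commutes, IsScalarTower.algebraMap_apply ℝ (RatFun r)
    (Polynomial (RatFun r)), Polynomial.algebraMap_eq, Polynomial.coe_C,
    ← IsScalarTower.algebraMap_apply ℝ (Poly r) (RatFun r)]

theorem shiftPoly_linPoly (k : Fin r) (l a : Fin r → ℝ) (hl : l k = 0) :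
    shiftPoly k l (linPoly a) = Polynomial.C (linRat (substForm k l a)) +
      Polynomial.C (algebraMap ℝ (RatFun r) (a k)) * Polynomial.X := by
  have hC : ∀ c : ℝ, shiftPoly k l (MvPolynomial.C c) =
      Polynomial.C (algebraMap ℝ (RatFun r) c) := fun c => by
    have h1 : (MvPolynomial.C c : Poly r) = algebraMap ℝ (Poly r) c := rfl
    rw [h1, AlgHom.commutes, IsScalarTower.algebraMap_apply ℝ (RatFun r)
      (Polynomial (RatFun r)), Polynomial.algebraMap_eq]
  have hX : ∀ j, shiftPoly k l (MvPolynomial.X j) = if j = k then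
      Polynomial.C (linRat l) + Polynomial.X else Polynomial.C (linRat (Pi.single j 1)) := by
    intro j
    rw [shiftPoly, MvPolynomial.aeval_X, linRat_apply, linRat_apply, linPoly_single]
  have hsub : substForm k l a = ∑ j, a j • if j = k then l else Pi.single j 1 := by
    ext i
    rw [Finset.sum_apply]
    by_cases hi : i = k
    · subst hi
      rw [Finset.sum_eq_single i]
      · simp [substForm, hl]
      · intro j _ hj
        simp [hj, hj.symm]
      · simp
    · rw [← Finset.sum_erase_add _ _ (Finset.mem_univ k), Finset.sum_eq_single i]
      · simp [substForm, hi]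
      · intro j hj hji
        simp [Finset.ne_of_mem_erase hj, hji.symm]
      · simp [hi]
  have hX' : (Polynomial.C (algebraMap ℝ (RatFun r) (a k)) * Polynomial.X :
      Polynomial (RatFun r)) = ∑ j, if j = k then
        Polynomial.C (algebraMap ℝ (RatFun r) (a j)) * Polynomial.X else 0 := by
    rw [Finset.sum_ite_eq' Finset.univ k fun j =>
      (Polynomial.C (algebraMap ℝ (RatFun r) (a j)) * Polynomial.X : Polynomial (RatFun r)),
      if_pos (Finset.mem_univ k)]
  rw [hsub, hX', linPoly, map_sum, map_sum, map_sum, ← Finset.sum_add_distrib]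
  refine Finset.sum_congr rfl fun j _ => ?_
  rw [map_mul, hC, hX, map_smul, Algebra.smul_def, Polynomial.C_mul]
  split_ifs
  · rw [mul_add]
  · rw [add_zero]

theorem laurentExpansion_linRat (k : Fin r) (l a : Fin r → ℝ) (hl : l k = 0) :
    laurentExpansion k l (linRat a) = HahnSeries.ofPowerSeries ℤ (RatFun r)
      (PowerSeries.C (linRat (substForm k l a)) +
        PowerSeries.C (algebraMap ℝ (RatFun r) (a k)) * PowerSeries.X) := by
  rw [linRat_apply, laurentExpansion_algebraMap, shiftLaurent_apply, shiftPoly_linPoly k l a hl]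
  simp

theorem laurentExpansion_linRat_inv (k : Fin r) (l a : Fin r → ℝ) (hl : l k = 0)
    (ha : substForm k l a ≠ 0) :
    laurentExpansion k l (linRat a)⁻¹ = HahnSeries.ofPowerSeries ℤ (RatFun r)
      (PowerSeries.C (linRat (substForm k l a)) +
        PowerSeries.C (algebraMap ℝ (RatFun r) (a k)) * PowerSeries.X)⁻¹ := by
  rw [map_inv₀, laurentExpansion_linRat k l a hl]
  symm
  apply eq_inv_of_mul_eq_one_left
  rw [← map_mul, PowerSeries.inv_mul_cancel, map_one]
  simpa [linRat_eq_zero_iff] using ha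

theorem laurentExpansion_linRat_inv_of_eq_zero (k : Fin r) (l a : Fin r → ℝ) (hl : l k = 0)
    (ha : substForm k l a = 0) :
    laurentExpansion k l (linRat a)⁻¹ =
      HahnSeries.single (-1) (algebraMap ℝ (RatFun r) (a k))⁻¹ := by
  rw [map_inv₀, laurentExpansion_linRat k l a hl, ha, map_zero, map_zero, zero_add, map_mul,
    HahnSeries.ofPowerSeries_C, HahnSeries.ofPowerSeries_X, HahnSeries.C_apply,
    HahnSeries.single_mul_single, zero_add, mul_one, HahnSeries.inv_single]

/-- The coefficients of the inverse of `c + a T` are polynomials in `c⁻¹` and `a`. -/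
theorem coeff_inv_linear_mem {K : Type*} [Field K] (R : Subring K) {c a : K} (hc : c ≠ 0)
    (hc' : c⁻¹ ∈ R) (ha : a ∈ R) (m : ℕ) :
    PowerSeries.coeff m (PowerSeries.C c + PowerSeries.C a * PowerSeries.X)⁻¹ ∈ R := by
  set q := (PowerSeries.C c + PowerSeries.C a * PowerSeries.X)⁻¹ with hq
  have h1 : q * (PowerSeries.C c + PowerSeries.C a * PowerSeries.X) = 1 :=
    PowerSeries.inv_mul_cancel _ (by simpa using hc)
  induction m with
  | zero =>
    have : PowerSeries.coeff 0 q = c⁻¹ := by simp [hq]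
    rwa [this]
  | succ m ih =>
    have h2 := congrArg (PowerSeries.coeff (m + 1)) h1
    rw [mul_add, ← mul_assoc, map_add, PowerSeries.coeff_succ_mul_X, PowerSeries.coeff_mul_C,
      PowerSeries.coeff_mul_C, PowerSeries.coeff_one, if_neg (Nat.succ_ne_zero m)] at h2
    have h3 : PowerSeries.coeff (m + 1) q = -(PowerSeries.coeff m q * a) * c⁻¹ := by
      rw [eq_mul_inv_iff_mul_eq₀ hc]
      linear_combination h2
    rw [h3]
    exact R.mul_mem (R.neg_mem (R.mul_mem ih ha)) hc'

/-! ### Rational functions with prescribed denominators -/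

/-- The algebra of rational functions whose denominators are products of the forms in `A`. -/
def polarAlg (A : Set (Fin r → ℝ)) : Subalgebra ℝ (RatFun r) :=
  Algebra.adjoin ℝ (Set.range linRat ∪ (fun a => (linRat a)⁻¹) '' A)

theorem linRat_mem_polarAlg (A : Set (Fin r → ℝ)) (a : Fin r → ℝ) : linRat a ∈ polarAlg A :=
  Algebra.subset_adjoin (Or.inl ⟨a, rfl⟩)

theorem linRat_inv_mem_polarAlg {A : Set (Fin r → ℝ)} {a : Fin r → ℝ} (ha : a ∈ A) :
    (linRat a)⁻¹ ∈ polarAlg A :=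
  Algebra.subset_adjoin (Or.inr ⟨a, ha, rfl⟩)

theorem algebraMap_mem_polarAlg (A : Set (Fin r → ℝ)) (p : Poly r) :
    algebraMap (Poly r) (RatFun r) p ∈ polarAlg A := by
  induction p using MvPolynomial.induction_on with
  | C c =>
    have h1 : (MvPolynomial.C c : Poly r) = algebraMap ℝ (Poly r) c := rfl
    rw [h1, ← IsScalarTower.algebraMap_apply ℝ (Poly r) (RatFun r)]
    exact Subalgebra.algebraMap_mem _ c
  | add p q hp hq => rw [map_add]; exact add_mem hp hq
  | mul_X p j hp =>
    rw [map_mul]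
    refine mul_mem hp ?_
    rw [← linPoly_single]
    exact linRat_mem_polarAlg A _

/-- Substituting `x_k = ℓ` in the denominators: the Laurent coefficients. -/
theorem coeff_laurentExpansion_mem {A A' : Set (Fin r → ℝ)} {k : Fin r} {l : Fin r → ℝ}
    (hl : l k = 0) (hA : ∀ a ∈ A, substForm k l a ≠ 0 → substForm k l a ∈ A') {f : RatFun r}
    (hf : f ∈ polarAlg A) (m : ℤ) : (laurentExpansion k l f).coeff m ∈ polarAlg A' := by
  have hps : ∀ p : PowerSeries (RatFun r), (∀ i, PowerSeries.coeff i p ∈ polarAlg A') →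
      ∀ m : ℤ, (HahnSeries.ofPowerSeries ℤ (RatFun r) p).coeff m ∈ polarAlg A' := by
    intro p hp m
    rw [PowerSeries.coeff_coe]
    split_ifs
    · exact zero_mem _
    · exact hp _
  have hr : ∀ c : ℝ, algebraMap ℝ (RatFun r) c ∈ polarAlg A' := Subalgebra.algebraMap_mem _
  induction hf using Algebra.adjoin_induction generalizing m with
  | mem x hx =>
    rcases hx with ⟨a, rfl⟩ | ⟨a, ha, rfl⟩
    · rw [laurentExpansion_linRat k l a hl]
      refine hps _ (fun i => ?_) m
      rw [map_add, PowerSeries.coeff_C, PowerSeries.coeff_C_mul, PowerSeries.coeff_X]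
      refine add_mem ?_ (mul_mem (hr _) ?_)
      · split_ifs
        · exact linRat_mem_polarAlg _ _
        · exact zero_mem _
      · split_ifs
        · exact one_mem _
        · exact zero_mem _
    · by_cases h0 : substForm k l a = 0
      · dsimp only
        rw [laurentExpansion_linRat_inv_of_eq_zero k l a hl h0, HahnSeries.coeff_single]
        split_ifs
        · rw [← map_inv₀]
          exact hr _
        · exact zero_mem _
      · dsimp only
        rw [laurentExpansion_linRat_inv k l a hl h0]
        refine hps _ (fun i => ?_) m
        exact coeff_inv_linear_mem (polarAlg A').toSubring (by rwa [Ne, linRat_eq_zero_iff])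
          (linRat_inv_mem_polarAlg (hA a ha h0)) (hr _) i
  | algebraMap c =>
    rw [laurentExpansion_real]
    refine hps _ (fun i => ?_) m
    rw [PowerSeries.coeff_C]
    split_ifs
    · exact hr _
    · exact zero_mem _
  | add x y _ _ hx hy =>
    rw [map_add, HahnSeries.coeff_add]
    exact add_mem (hx m) (hy m)
  | mul x y _ _ hx hy =>
    rw [map_mul, HahnSeries.coeff_mul]
    exact sum_mem fun i _ => mul_mem (hx _) (hy _)

theorem coeff_expSeries (c : ℝ) (m : ℤ) : ∃ t : ℝ,
    (expSeries (r := r) c).coeff m = algebraMap ℝ (RatFun r) t := by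
  rw [expSeries, PowerSeries.coeff_coe]
  split_ifs
  · exact ⟨0, (map_zero _).symm⟩
  · rw [PowerSeries.coeff_mk]
    exact ⟨_, rfl⟩

/-- Controls the poles through the iteration: a residue at `x_k = ℓ` has only the substituted forms
in its denominator. -/
theorem residueAt_mem {A A' : Set (Fin r → ℝ)} {k : Fin r} {l : Fin r → ℝ}
    (hl : l k = 0) (hA : ∀ a ∈ A, substForm k l a ≠ 0 → substForm k l a ∈ A') (c : ℝ)
    {f : RatFun r} (hf : f ∈ polarAlg A) : residueAt k l c f ∈ polarAlg A' := by
  rw [residueAt, HahnSeries.coeff_mul]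
  refine sum_mem fun i _ => mul_mem (coeff_laurentExpansion_mem hl hA hf _) ?_
  obtain ⟨t, ht⟩ := coeff_expSeries (r := r) c i.2
  rw [ht]
  exact Subalgebra.algebraMap_mem _ _

theorem residueAt_eq_zero_of_mem_range {k : Fin r} {l : Fin r → ℝ} {c : ℝ} {f : RatFun r}
    (hf : laurentExpansion k l f ∈ (HahnSeries.ofPowerSeries ℤ (RatFun r)).range) :
    residueAt k l c f = 0 := by
  obtain ⟨p, hp⟩ := hf
  rw [residueAt, ← hp, expSeries, ← map_mul, PowerSeries.coeff_coe, if_pos (by norm_num)]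

/-- If no denominator vanishes at `x_k = ℓ`, every generator of the algebra expands into a power
series, and so does `f`. -/
theorem residueAt_eq_zero {A : Set (Fin r → ℝ)} {k : Fin r} {l : Fin r → ℝ}
    (hl : l k = 0) (hA : ∀ a ∈ A, substForm k l a ≠ 0) (c : ℝ)
    {f : RatFun r} (hf : f ∈ polarAlg A) : residueAt k l c f = 0 := by
  apply residueAt_eq_zero_of_mem_range
  induction hf using Algebra.adjoin_induction with
  | mem x hx =>
    rcases hx with ⟨a, rfl⟩ | ⟨a, ha, rfl⟩
    · exact ⟨_, (laurentExpansion_linRat k l a hl).symm⟩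
    · exact ⟨_, (laurentExpansion_linRat_inv k l a hl (hA a ha)).symm⟩
  | algebraMap c => exact ⟨_, (laurentExpansion_real k l c).symm⟩
  | add x y _ _ hx hy => rw [map_add]; exact add_mem hx hy
  | mul x y _ _ hx hy => rw [map_mul]; exact mul_mem hx hy

/-! ### Linearity of the residues -/

/-- Write `f = p / q` and view `q` as a non-zero polynomial in `x_k` over the rational functions. A
pole `ℓ` must be one of its finitely many roots; elsewhere `q` is invertible as a power series. -/
theorem finite_residueAt_ne_zero (k : Fin r) (c : ℝ) (f : RatFun r) :
    {l : Fin r → ℝ | l k = 0 ∧ residueAt k l c f ≠ 0}.Finite := by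
  obtain ⟨p, q, hq, rfl⟩ := IsFractionRing.div_surjective (A := Poly r) f
  have hq0 : q ≠ 0 := nonZeroDivisors.ne_zero hq
  set Q := shiftPoly k 0 q with hQ
  have hQ0 : Q ≠ 0 := by
    rw [hQ, Ne, map_eq_zero_iff _ (shiftPoly_injective k 0)]
    exact hq0
  have heval : ∀ l : Fin r → ℝ, (shiftPoly k l q).eval 0 = Q.eval (linRat l) := by
    intro l
    have : ((Polynomial.aeval (R := RatFun r) (0 : RatFun r)).restrictScalars ℝ).comp
        (shiftPoly k l) = ((Polynomial.aeval (R := RatFun r) (linRat l)).restrictScalars ℝ).comp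
          (shiftPoly k 0) := by
      apply MvPolynomial.algHom_ext
      intro j
      by_cases hj : j = k
      · simp [shiftPoly, hj, linRat_apply]
        simp [linPoly]
      · simp [shiftPoly, hj]
    simpa [hQ, Polynomial.coe_aeval_eq_eval] using DFunLike.congr_fun this q
  refine ((Q.roots.toFinset.finite_toSet).preimage (f := linRat)
    linRat_injective.injOn).subset ?_
  rintro l ⟨-, hl⟩
  rw [Set.mem_preimage, Finset.mem_coe, Multiset.mem_toFinset, Polynomial.mem_roots hQ0,
    Polynomial.IsRoot, ← heval]
  by_contra h0
  apply hl
  apply residueAt_eq_zero_of_mem_range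
  refine ⟨(shiftPoly k l p : PowerSeries (RatFun r)) *
    (shiftPoly k l q : PowerSeries (RatFun r))⁻¹, ?_⟩
  rw [map_mul, map_div₀, laurentExpansion_algebraMap, laurentExpansion_algebraMap,
    shiftLaurent_apply, shiftLaurent_apply, div_eq_mul_inv]
  congr 1
  apply eq_inv_of_mul_eq_one_left
  rw [← map_mul, PowerSeries.inv_mul_cancel, map_one]
  rw [Polynomial.constantCoeff_coe, Polynomial.coeff_zero_eq_eval_zero]
  exact h0

theorem residueAt_add (k : Fin r) (l : Fin r → ℝ) (c : ℝ) (f g : RatFun r) :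
    residueAt k l c (f + g) = residueAt k l c f + residueAt k l c g := by
  rw [residueAt, map_add, add_mul, HahnSeries.coeff_add]; rfl

theorem residueAt_smul (k : Fin r) (l : Fin r → ℝ) (c t : ℝ) (f : RatFun r) :
    residueAt k l c (t • f) = t • residueAt k l c f := by
  rw [residueAt, Algebra.smul_def, map_mul, laurentExpansion_real, HahnSeries.ofPowerSeries_C,
    mul_assoc, HahnSeries.C_mul_eq_smul, HahnSeries.coeff_smul, smul_eq_mul, Algebra.smul_def]
  rfl

/-- The set `s` may be larger than the set of poles, which allows one common index set for several
functions. -/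
theorem resInfty_eq_sum (k : Fin r) (μ : Fin r → ℝ) (f : RatFun r) (s : Finset (Fin r → ℝ))
    (hs : ∀ l ∈ s, l k = 0) (hs' : ∀ l, l k = 0 → l ∉ s → residueAt k l (μ k) f = 0) :
    resInfty k μ f =
      ∑ l ∈ s, Finsupp.single (substForm k l μ) (residueAt k l (μ k) f) := by
  rw [resInfty, finsum_eq_sum_of_support_subset (s := s)]
  · refine Finset.sum_congr rfl fun l hl => ?_
    rw [finsum_eq_if, if_pos (hs l hl)]
  · intro l hl
    rw [Function.mem_support, finsum_eq_if] at hl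
    by_contra hls
    apply hl
    split_ifs with h
    · rw [hs' l h hls, Finsupp.single_zero]
    · rfl

theorem resInfty_add (k : Fin r) (μ : Fin r → ℝ) (f g : RatFun r) :
    resInfty k μ (f + g) = resInfty k μ f + resInfty k μ g := by
  classical
  set s := (finite_residueAt_ne_zero k (μ k) f).toFinset ∪
    (finite_residueAt_ne_zero k (μ k) g).toFinset with hs
  have h0 : ∀ l ∈ s, l k = 0 := by
    intro l hl
    rcases Finset.mem_union.mp hl with h | h <;> exact ((Set.Finite.mem_toFinset _).mp h).1
  have hf : ∀ l, l k = 0 → l ∉ s → residueAt k l (μ k) f = 0 := by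
    intro l hl hls
    by_contra h
    exact hls (Finset.mem_union_left _ ((Set.Finite.mem_toFinset _).mpr ⟨hl, h⟩))
  have hg : ∀ l, l k = 0 → l ∉ s → residueAt k l (μ k) g = 0 := by
    intro l hl hls
    by_contra h
    exact hls (Finset.mem_union_right _ ((Set.Finite.mem_toFinset _).mpr ⟨hl, h⟩))
  rw [resInfty_eq_sum k μ f s h0 hf, resInfty_eq_sum k μ g s h0 hg,
    resInfty_eq_sum k μ (f + g) s h0 fun l hl hls => by
      rw [residueAt_add, hf l hl hls, hg l hl hls, add_zero], ← Finset.sum_add_distrib]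
  refine Finset.sum_congr rfl fun l _ => ?_
  rw [residueAt_add, Finsupp.single_add]

theorem resInfty_smul (k : Fin r) (μ : Fin r → ℝ) (t : ℝ) (f : RatFun r) :
    resInfty k μ (t • f) = t • resInfty k μ f := by
  set s := (finite_residueAt_ne_zero k (μ k) f).toFinset with hs
  have h0 : ∀ l ∈ s, l k = 0 := fun l hl => ((Set.Finite.mem_toFinset _).mp hl).1
  have hf : ∀ l, l k = 0 → l ∉ s → residueAt k l (μ k) f = 0 := by
    intro l hl hls
    by_contra h
    exact hls ((Set.Finite.mem_toFinset _).mpr ⟨hl, h⟩)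
  rw [resInfty_eq_sum k μ f s h0 hf, resInfty_eq_sum k μ (t • f) s h0 fun l hl hls => by
      rw [residueAt_smul, hf l hl hls, smul_zero], Finset.smul_sum]
  refine Finset.sum_congr rfl fun l _ => ?_
  rw [residueAt_smul, Finsupp.smul_single]

theorem resInfty_zero (k : Fin r) (μ : Fin r → ℝ) : resInfty k μ (0 : RatFun r) = 0 := by
  simpa using resInfty_smul k μ 0 (0 : RatFun r)

/-- `Res⁺_{x_k}` as a linear map. -/
def resPlusLin (k : Fin r) : ExpRat r →ₗ[ℝ] ExpRat r where
  toFun := resPlus k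
  map_add' g h := by
    apply Finsupp.sum_add_index'
    · intro μ
      rw [resInfty_zero, ite_self]
    · intro μ f₁ f₂
      rw [resInfty_add]
      split_ifs
      · rfl
      · rw [add_zero]
  map_smul' t h := by
    rw [RingHom.id_apply, resPlus, Finsupp.sum_smul_index', resPlus, Finsupp.smul_sum]
    · refine Finsupp.sum_congr fun μ _ => ?_
      rw [resInfty_smul, smul_ite, smul_zero]
    · intro μ
      rw [resInfty_zero, ite_self]

/-- The iterated `Res⁺` in the coordinates of the list `ks`, the first one being taken first. -/
def resFold (ks : List (Fin r)) : ExpRat r →ₗ[ℝ] ExpRat r :=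
  ks.foldl (fun φ k => resPlusLin k ∘ₗ φ) LinearMap.id

theorem resFold_apply (ks : List (Fin r)) (h : ExpRat r) :
    resFold ks h = ks.foldl (fun g k => resPlus k g) h := by
  suffices H : ∀ φ : ExpRat r →ₗ[ℝ] ExpRat r, ks.foldl (fun φ k => resPlusLin k ∘ₗ φ) φ h =
      ks.foldl (fun g k => resPlus k g) (φ h) from H LinearMap.id
  induction ks with
  | nil => intro φ; rfl
  | cons k ks ih => intro φ; exact ih _

theorem resFold_cons (k : Fin r) (ks : List (Fin r)) (h : ExpRat r) :
    resFold (k :: ks) h = resFold ks (resPlus k h) := by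
  rw [resFold_apply, resFold_apply, List.foldl_cons]

theorem resPlus_single (k : Fin r) (μ : Fin r → ℝ) (f : RatFun r) :
    resPlus k (Finsupp.single μ f) = if 0 ≤ μ k then resInfty k μ f else 0 := by
  rw [resPlus, Finsupp.sum_single_index]
  rw [resInfty_zero, ite_self]

end LinearForms

/-! ### Vanishing of iterated residues and the lexicographic weights -/

section Iterated

variable {r : ℕ}

/-- Substitution is a translation in the single direction `ℓ - e_k`. If `ℓ` is a pole of `1 / a`,
this direction is a multiple of `a`. -/
theorem substForm_eq (k : Fin r) (l a : Fin r → ℝ) (hl : l k = 0) :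
    substForm k l a = a + a k • (l - Pi.single k 1) := by
  ext j
  by_cases hj : j = k
  · subst hj
    simp [substForm, hl]
  · simp [substForm, hj]

theorem resFold_sum_single {ι : Type*} (ks : List (Fin r)) (s : Finset ι)
    (μ : ι → Fin r → ℝ) (f : ι → RatFun r) :
    resFold ks (∑ i ∈ s, Finsupp.single (μ i) (f i)) =
      ∑ i ∈ s, resFold ks (Finsupp.single (μ i) (f i)) := map_sum _ _ _

/-! ### Vanishing on functions with few poles -/

/-- The iterated residue of `f e^μ` vanishes if `μ` is not in the span of the poles of `f`. -/
theorem resFold_eq_zero (ks : List (Fin r)) (W : Submodule ℝ (Fin r → ℝ)) :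
    ∀ (μ : Fin r → ℝ), μ ∉ W → (∀ j, j ∉ ks → μ j = 0) →
      ∀ f ∈ polarAlg {a | a ∈ W ∧ a ≠ 0 ∧ ∀ j, j ∉ ks → a j = 0},
        resFold ks (Finsupp.single μ f) = 0 := by
  induction ks with
  | nil =>
    intro μ hμ hμ0 f _
    -- No coordinate is left, so `μ = 0` would lie in `W`.
    exact absurd (by rw [show μ = 0 from funext fun j => hμ0 j (by simp)]; exact W.zero_mem) hμ
  | cons k ks ih =>
    intro μ hμ hμ0 f hf
    rw [resFold_cons, resPlus_single]
    split_ifs with hk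
    swap
    · rw [map_zero]
    rw [resInfty_eq_sum k μ f (finite_residueAt_ne_zero k (μ k) f).toFinset
      (fun l hl => ((Set.Finite.mem_toFinset _).mp hl).1) (fun l hl hls => by
        by_contra h
        exact hls ((Set.Finite.mem_toFinset _).mpr ⟨hl, h⟩)), resFold_sum_single]
    refine Finset.sum_eq_zero fun l hl => ?_
    obtain ⟨hl0, hne⟩ := (Set.Finite.mem_toFinset _).mp hl
    -- A non-zero residue requires some form `a ∈ W` in the denominator that vanishes at `x_k = ℓ`.
    have hpole : ∃ a : Fin r → ℝ, (a ∈ W ∧ a ≠ 0 ∧ ∀ j, j ∉ k :: ks → a j = 0) ∧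
        substForm k l a = 0 := by
      by_contra! h
      exact hne (residueAt_eq_zero hl0 h _ hf)
    obtain ⟨a, ⟨haW, ha0, haj⟩, hal⟩ := hpole
    rw [substForm_eq k l a hl0] at hal
    have hak : a k ≠ 0 := by
      intro h
      rw [h, zero_smul, add_zero] at hal
      exact ha0 hal
    -- The direction of the substitution is a multiple of `a ∈ W`, so neither `μ` nor the remaining
    -- poles change modulo `W`.
    have hd : l - Pi.single k 1 = -(a k)⁻¹ • a := by
      rw [neg_smul, ← smul_neg, ← eq_neg_of_add_eq_zero_right hal, smul_smul,
        inv_mul_cancel₀ hak, one_smul]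
    have hdW : l - Pi.single k 1 ∈ W := hd ▸ W.smul_mem _ haW
    have hsub0 : ∀ b : Fin r → ℝ, (∀ j, j ∉ k :: ks → b j = 0) →
        ∀ j, j ∉ ks → substForm k l b j = 0 := by
      intro b hb j hj
      by_cases hjk : j = k
      · simp [substForm, hjk]
      · have hj' : j ∉ k :: ks := by simp [hjk, hj]
        rw [substForm_eq k l b hl0, hd, Pi.add_apply, Pi.smul_apply, Pi.smul_apply, hb j hj',
          haj j hj']
        simp
    apply ih
    · intro h
      rw [substForm_eq k l μ hl0] at h
      exact hμ ((W.add_mem_iff_left (W.smul_mem _ hdW)).mp h)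
    · exact hsub0 μ hμ0
    · refine residueAt_mem hl0 ?_ _ hf
      rintro b ⟨hbW, _, hbj⟩ hb0
      refine ⟨?_, hb0, hsub0 b hbj⟩
      rw [substForm_eq k l b hl0]
      exact W.add_mem hbW (W.smul_mem _ hdW)

/-! ### The iterated residue of `e^μ / ∏ β_i` for a basis `β` -/

/-- Order `A` by `g`. The `j`-th summand has factors `h i` above `j` and `h i - 1` below `j`; since
`h j - (h j - 1) = 1`, it is a difference of two consecutive mixed products, and the sum telescopes.
-/
theorem sum_prod_erase_sub {ι γ R : Type*} [DecidableEq ι] [LinearOrder γ] [CommRing R]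
    (A : Finset ι) (g : ι → γ) (hg : Set.InjOn g A) (h : ι → R) :
    ∑ j ∈ A, ∏ i ∈ A.erase j, (h i - if g j < g i then 0 else 1) =
      ∏ i ∈ A, h i - ∏ i ∈ A, (h i - 1) := by
  induction A using Finset.induction_on_max_value g with
  | empty => simp
  | insert a A ha hmax ih =>
    have hlt : ∀ x ∈ A, g x < g a := fun x hx => lt_of_le_of_ne (hmax x hx) fun he =>
      ha (hg (Finset.mem_insert_of_mem hx) (Finset.mem_insert_self a A) he ▸ hx)
    rw [Finset.sum_insert ha, Finset.prod_insert ha, Finset.prod_insert ha, Finset.erase_insert ha]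
    have h1 : ∀ j ∈ A, ∏ i ∈ (insert a A).erase j, (h i - if g j < g i then 0 else 1) =
        h a * ∏ i ∈ A.erase j, (h i - if g j < g i then 0 else 1) := by
      intro j hj
      rw [Finset.erase_insert_of_ne (by rintro rfl; exact ha hj),
        Finset.prod_insert (fun h => ha (Finset.mem_of_mem_erase h)), if_pos (hlt j hj), sub_zero]
    have h2 : ∏ i ∈ A, (h i - if g a < g i then 0 else 1) = ∏ i ∈ A, (h i - 1) :=
      Finset.prod_congr rfl fun i hi => by rw [if_neg (hlt i hi).not_gt]
    rw [Finset.sum_congr rfl h1, ← Finset.mul_sum,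
      ih (hg.mono (Finset.coe_subset.mpr (Finset.subset_insert a A))), h2]
    ring

/-- The first non-zero coefficient of `β` is positive. -/
def LexPos (β : Fin r → ℝ) : Prop := 0 < toLex β

open scoped Classical in
/-- The contribution of a form `β` with coefficient `c` to the iterated residue. -/
def lexWeight (β : Fin r → ℝ) (c : ℝ) : ℝ :=
  (if 0 < c then 1 else 0) - if LexPos β then 0 else 1

theorem lexPos_smul {a : ℝ} (ha : 0 < a) {β : Fin r → ℝ} : LexPos (a • β) ↔ LexPos β := by
  have key : ∀ {a : ℝ} (_ : 0 < a) {β : Fin r → ℝ}, LexPos β → LexPos (a • β) := by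
    rintro a ha β ⟨k, hk, hk'⟩
    refine ⟨k, fun j hj => ?_, ?_⟩
    · have h0 : (0 : ℝ) = β j := hk j hj
      change (0 : ℝ) = a * β j
      rw [← h0, mul_zero]
    · have h0 : (0 : ℝ) < β k := hk'
      exact mul_pos ha h0
  refine ⟨fun h => ?_, key ha⟩
  have := key (inv_pos.mpr ha) h
  rwa [smul_smul, inv_mul_cancel₀ ha.ne', one_smul] at this

theorem lexPos_neg {β : Fin r → ℝ} (hβ : β ≠ 0) : LexPos (-β) ↔ ¬ LexPos β := by
  have h3 : toLex β ≠ 0 := hβ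
  rw [LexPos, LexPos, toLex_neg, neg_pos]
  exact ⟨fun h => h.not_gt, fun h => lt_of_le_of_ne (not_lt.mp h) h3⟩

theorem lexWeight_of_pos {β : Fin r → ℝ} (h : LexPos β) (c : ℝ) :
    lexWeight β c = if 0 < c then 1 else 0 := by
  rw [lexWeight, if_pos h, sub_zero]

theorem lexWeight_of_not_pos {β : Fin r → ℝ} (h : ¬ LexPos β) (c : ℝ) :
    lexWeight β c = (if 0 < c then 1 else 0) - 1 := by
  rw [lexWeight, if_neg h]

/-- A positive factor changes nothing. Replacing `(β, c)` by `(-β, -c)` leaves `c • β` unchanged and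
negates `1 / β`, so the weight has to change sign; for this `c ≠ 0` is essential. Every form can
thus be normalised to be lexicographically positive. -/
theorem lexWeight_smul {a c : ℝ} {β : Fin r → ℝ} (ha : a ≠ 0) (hc : c ≠ 0) (hβ : β ≠ 0) :
    lexWeight (a • β) c = (SignType.sign a : ℝ) * lexWeight β (a * c) := by
  rcases ha.lt_or_gt with ha | ha
  · have h1 : LexPos (a • β) ↔ ¬ LexPos β := by
      rw [← lexPos_neg hβ, ← lexPos_smul (neg_pos.mpr ha) (β := -β), neg_smul_neg]
    have h4 : 0 < a * c ↔ ¬ 0 < c := by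
      rw [not_lt]
      exact ⟨fun h => (neg_of_mul_pos_right h ha.le).le,
        fun h => mul_pos_of_neg_of_neg ha (lt_of_le_of_ne h hc)⟩
    by_cases hq : LexPos β
    · rw [lexWeight_of_pos hq, lexWeight_of_not_pos (fun h => h1.mp h hq)]
      by_cases hp : 0 < c <;> simp [h4, hp, sign_neg ha]
    · rw [lexWeight_of_not_pos hq, lexWeight_of_pos (h1.mpr hq)]
      by_cases hp : 0 < c <;> simp [h4, hp, sign_neg ha]
  · have h4 : 0 < a * c ↔ 0 < c := mul_pos_iff_of_pos_left ha
    by_cases hq : LexPos β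
    · rw [lexWeight_of_pos hq, lexWeight_of_pos ((lexPos_smul ha).mpr hq)]
      simp [h4, sign_pos ha]
    · rw [lexWeight_of_not_pos hq, lexWeight_of_not_pos (mt (lexPos_smul ha).mp hq)]
      simp [h4, sign_pos ha]

theorem lexPos_of_apply_pos {β : Fin r → ℝ} {k : Fin r} (h0 : ∀ j < k, β j = 0)
    (hk : 0 < β k) : LexPos β :=
  ⟨k, fun j hj => (h0 j hj).symm, hk⟩

/-- The combinatorial identity behind one step of the iterated residue: `β i`, `i ∈ A`, are the
forms involving the coordinate `x_k`, with coefficients `β i k`. -/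
theorem sum_lexWeight {ι : Type*} [DecidableEq ι] (k : Fin r) (A : Finset ι) (hA : A.Nonempty)
    (β : ι → Fin r → ℝ) (hlt : ∀ i ∈ A, ∀ j < k, β i j = 0) (hk : ∀ i ∈ A, β i k ≠ 0)
    (hinj : ∀ i ∈ A, ∀ j ∈ A, i ≠ j → β i - (β i k / β j k) • β j ≠ 0)
    (c : ι → ℝ) (hc : ∀ i ∈ A, c i ≠ 0) :
    (if 0 ≤ ∑ i ∈ A, c i * β i k then
      ∑ j ∈ A, (SignType.sign (β j k) : ℝ) *
        ∏ i ∈ A.erase j, lexWeight (β i - (β i k / β j k) • β j) (c i)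
      else 0) = ∏ i ∈ A, lexWeight (β i) (c i) := by
  classical
  -- Normalise the coefficient of `x_k` to `1`. Then all `γ i` are lexicographically positive, and
  -- the form left after substituting the pole of `β j` is `β i k • (γ i - γ j)`, whose sign is that
  -- of `β i k` combined with the order of `γ i` and `γ j`.
  set γ : ι → Fin r → ℝ := fun i => (β i k)⁻¹ • β i with hγ
  set h : ι → ℝ := fun i => if 0 < β i k * c i then 1 else 0 with hh
  have hβγ : ∀ i ∈ A, β i = β i k • γ i := fun i hi => by
    rw [hγ, smul_smul, mul_inv_cancel₀ (hk i hi), one_smul]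
  have hγpos : ∀ i ∈ A, LexPos (γ i) := fun i hi =>
    lexPos_of_apply_pos (k := k) (fun j hj => by simp [hγ, hlt i hi j hj])
      (by simp [hγ, hk i hi])
  have hdiff : ∀ i ∈ A, ∀ j ∈ A, β i - (β i k / β j k) • β j = β i k • (γ i - γ j) := by
    intro i hi j hj
    rw [smul_sub, ← hβγ i hi, hγ, smul_smul, div_eq_mul_inv]
  have hne : ∀ i ∈ A, ∀ j ∈ A, i ≠ j → γ i - γ j ≠ 0 := by
    intro i hi j hj hij h0
    apply hinj i hi j hj hij
    rw [hdiff i hi j hj, h0, smul_zero]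
  have hginj : Set.InjOn (fun i => toLex (γ i)) A := by
    intro i hi j hj hij
    by_contra hij'
    exact hne i hi j hj hij' (sub_eq_zero.mpr (toLex.injective hij))
  have hR : ∏ i ∈ A, lexWeight (β i) (c i) =
      (∏ i ∈ A, (SignType.sign (β i k) : ℝ)) * ∏ i ∈ A, h i := by
    rw [← Finset.prod_mul_distrib]
    refine Finset.prod_congr rfl fun i hi => ?_
    conv_lhs => rw [hβγ i hi]
    rw [lexWeight_smul (hk i hi) (hc i hi) (fun h0 => (hγpos i hi).ne' (by rw [h0]; rfl)),
      lexWeight_of_pos (hγpos i hi)]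
  have hL : ∑ j ∈ A, (SignType.sign (β j k) : ℝ) *
        ∏ i ∈ A.erase j, lexWeight (β i - (β i k / β j k) • β j) (c i) =
      (∏ i ∈ A, (SignType.sign (β i k) : ℝ)) * (∏ i ∈ A, h i - ∏ i ∈ A, (h i - 1)) := by
    rw [← sum_prod_erase_sub A (fun i => toLex (γ i)) hginj h, Finset.mul_sum]
    refine Finset.sum_congr rfl fun j hj => ?_
    rw [← Finset.mul_prod_erase A _ hj, mul_assoc, ← Finset.prod_mul_distrib]
    congr 1
    refine Finset.prod_congr rfl fun i hi => ?_
    obtain ⟨hij, hi⟩ := Finset.mem_erase.mp hi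
    rw [hdiff i hi j hj, lexWeight_smul (hk i hi) (hc i hi) (hne i hi j hj hij), lexWeight]
    have hlex : LexPos (γ i - γ j) ↔ toLex (γ j) < toLex (γ i) := by
      rw [LexPos, toLex_sub, sub_pos]
    congr 2
    exact if_congr hlex rfl rfl
  rw [hL, hR]
  -- The terms `c i * β i k` are non-zero. If their sum is non-negative, one of them is positive and
  -- kills `∏ (h i - 1)`; if the sum is negative, one of them is negative and kills `∏ h i`, in
  -- agreement with `Res⁺ = 0`.
  split_ifs with h0
  · have : ∏ i ∈ A, (h i - 1) = 0 := by
      obtain ⟨i, hi, hi'⟩ : ∃ i ∈ A, 0 < β i k * c i := by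
        by_contra! hcon
        have : ∑ i ∈ A, c i * β i k < 0 := Finset.sum_neg (fun i hi =>
          lt_of_le_of_ne (mul_comm (c i) _ ▸ hcon i hi) (mul_ne_zero (hc i hi) (hk i hi))) hA
        exact absurd h0 this.not_ge
      exact Finset.prod_eq_zero hi (by simp [hh, hi'])
    rw [this, sub_zero]
  · have : ∏ i ∈ A, h i = 0 := by
      obtain ⟨i, hi, hi'⟩ : ∃ i ∈ A, ¬ 0 < β i k * c i := by
        by_contra! hcon
        exact h0 (Finset.sum_nonneg fun i hi => (mul_comm (c i) _ ▸ (hcon i hi).le))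
      exact Finset.prod_eq_zero hi (by simp only [hh, if_neg hi'])
    rw [this, mul_zero]

end Iterated

/-! ### The iterated residue of a simple fraction over a basis -/

section Iterated

variable {r : ℕ}

theorem prod_linRat_inv_mem {ι : Type*} (s : Finset ι) (β : ι → Fin r → ℝ) :
    ∏ i ∈ s, (linRat (β i))⁻¹ ∈ polarAlg (β '' s) :=
  prod_mem fun i hi => linRat_inv_mem_polarAlg ⟨i, hi, rfl⟩

/-- The residue of `e^μ / ∏ β_i` at a simple pole. -/
theorem residueAt_prod_inv {ι : Type*} [DecidableEq ι] {k : Fin r} {l : Fin r → ℝ} (hl : l k = 0)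
    (c : ℝ) (s : Finset ι) (β : ι → Fin r → ℝ) {j : ι} (hj : j ∈ s)
    (hj0 : substForm k l (β j) = 0) (hs : ∀ i ∈ s.erase j, substForm k l (β i) ≠ 0) :
    residueAt k l c (∏ i ∈ s, (linRat (β i))⁻¹) =
      (β j k)⁻¹ • ∏ i ∈ s.erase j, (linRat (substForm k l (β i)))⁻¹ := by
  have h1 : ∏ i ∈ s.erase j, laurentExpansion k l (linRat (β i))⁻¹ =
      HahnSeries.ofPowerSeries ℤ (RatFun r) (∏ i ∈ s.erase j,
        (PowerSeries.C (linRat (substForm k l (β i))) +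
        PowerSeries.C (algebraMap ℝ (RatFun r) (β i k)) * PowerSeries.X)⁻¹) := by
    rw [map_prod]
    exact Finset.prod_congr rfl fun i hi => laurentExpansion_linRat_inv k l _ hl (hs i hi)
  rw [residueAt, ← Finset.mul_prod_erase s _ hj, map_mul, map_prod,
    laurentExpansion_linRat_inv_of_eq_zero k l _ hl hj0, h1, expSeries, mul_assoc, ← map_mul]
  -- The factor `(β j k * T)⁻¹` shifts coefficient `-1` to coefficient `0` of the remaining power
  -- series, to which the exponential contributes `1`.
  have h2 := HahnSeries.coeff_single_mul_add (r := (algebraMap ℝ (RatFun r) (β j k))⁻¹)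
    (x := HahnSeries.ofPowerSeries ℤ (RatFun r) ((∏ i ∈ s.erase j,
        (PowerSeries.C (linRat (substForm k l (β i))) +
        PowerSeries.C (algebraMap ℝ (RatFun r) (β i k)) * PowerSeries.X)⁻¹) *
        PowerSeries.mk fun m => algebraMap ℝ (RatFun r) (c ^ m / (m.factorial : ℝ))))
    (a := (0 : ℤ)) (b := -1)
  rw [zero_add] at h2
  rw [h2, ← map_inv₀, ← Algebra.smul_def]
  congr 1
  have h3 := HahnSeries.ofPowerSeries_apply_coeff (Γ := ℤ) ((∏ i ∈ s.erase j,
        (PowerSeries.C (linRat (substForm k l (β i))) +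
        PowerSeries.C (algebraMap ℝ (RatFun r) (β i k)) * PowerSeries.X)⁻¹) *
        PowerSeries.mk fun m => algebraMap ℝ (RatFun r) (c ^ m / (m.factorial : ℝ))) 0
  rw [Nat.cast_zero] at h3
  rw [h3, PowerSeries.coeff_zero_eq_constantCoeff_apply, map_mul, map_prod,
    ← PowerSeries.coeff_zero_eq_constantCoeff_apply (PowerSeries.mk _), PowerSeries.coeff_mk]
  simp [PowerSeries.constantCoeff_inv]

/-- Base case of the iteration: when all forms are used up, the matrix is a permutation matrix. -/
theorem abs_det_of_rows_single (β : Matrix (Fin r) (Fin r) ℝ) (hdet : β.det ≠ 0)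
    (h : ∀ i, ∃ j, β i = Pi.single j 1) : |β.det| = 1 := by
  choose τ hτ using h
  have hinj : Function.Injective τ := by
    intro i j hij
    by_contra hne
    exact hdet (Matrix.det_zero_of_row_eq hne (by rw [hτ, hτ, hij]))
  have : β = (Equiv.ofBijective τ (Finite.injective_iff_bijective.mp hinj)).toPEquiv.toMatrix := by
    ext i j
    rw [PEquiv.toMatrix_apply, hτ]
    simp [Pi.single_apply, eq_comm]
  rw [this, Matrix.det_permutation]
  rcases Int.units_eq_one_or (Equiv.Perm.sign (Equiv.ofBijective τ
    (Finite.injective_iff_bijective.mp hinj))) with h | h <;> simp [h]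

/-- The matrix with rows `β i - (β i k / β j k) • β j` for `i ≠ j`, and with `j`-th row `e_k`. -/
def pivotMatrix (β : Matrix (Fin r) (Fin r) ℝ) (j k : Fin r) : Matrix (Fin r) (Fin r) ℝ :=
  fun i => if i = j then Pi.single k 1 else β i - (β i k / β j k) • β j

theorem pivotMatrix_of_ne (β : Matrix (Fin r) (Fin r) ℝ) {i j : Fin r} (k : Fin r) (h : i ≠ j) :
    pivotMatrix β j k i = β i - (β i k / β j k) • β j := if_neg h

theorem pivotMatrix_self (β : Matrix (Fin r) (Fin r) ℝ) (j k : Fin r) :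
    pivotMatrix β j k j = Pi.single k 1 := if_pos rfl

/-- Row operations clear column `k` outside row `j`. The determinant is then `β j k` times its
cofactor, which is the determinant with row `j` replaced by `e_k`. -/
theorem det_pivotMatrix_mul (β : Matrix (Fin r) (Fin r) ℝ) (j k : Fin r) (hjk : β j k ≠ 0) :
    (pivotMatrix β j k).det * β j k = β.det := by
  set C : Matrix (Fin r) (Fin r) ℝ := fun i => if i = j then β j else β i - (β i k / β j k) • β j
    with hC
  have h1 : β.det = C.det := by
    refine Matrix.det_eq_of_forall_row_eq_smul_add_const
      (fun i => if i = j then 0 else β i k / β j k) j (if_pos rfl) fun i m => ?_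
    by_cases hij : i = j
    · simp [hC, hij]
    · simp [hC, hij]
  have h2 : pivotMatrix β j k = C.updateRow j (Pi.single k 1) := by
    ext i m
    by_cases hij : i = j
    · subst hij
      rw [pivotMatrix_self, Matrix.updateRow_self]
    · rw [pivotMatrix_of_ne β k hij, Matrix.updateRow_ne hij]
      simp [hC, hij]
  have h3 := congrFun (congrFun (Matrix.adjugate_mul C) k) k
  rw [Matrix.mul_apply, Finset.sum_eq_single j] at h3
  · rw [h1, h2, ← Matrix.adjugate_apply]
    simpa [hC] using h3
  · intro i _ hij
    simp [hC, hij, hjk]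
  · simp

theorem constExpRat_sum {ι : Type*} (s : Finset ι) (f : ι → ℝ) :
    ∑ i ∈ s, constExpRat (r := r) (f i) = constExpRat (∑ i ∈ s, f i) := by
  simp only [constExpRat, map_sum]
  exact (map_sum (Finsupp.singleAddHom (0 : Fin r → ℝ)) _ _).symm

theorem smul_constExpRat (t c : ℝ) :
    t • constExpRat (r := r) c = constExpRat (t * c) := by
  rw [constExpRat, Finsupp.smul_single, constExpRat, map_mul, Algebra.smul_def]

/-- The iterated residue of `e^μ / ∏ β_i` for linearly independent `β_i`: one step. -/
theorem resPlus_prod_inv (k : Fin r) (s : Finset (Fin r)) (β : Matrix (Fin r) (Fin r) ℝ)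
    (hdet : β.det ≠ 0) (c : Fin r → ℝ) :
    resPlus k (Finsupp.single (∑ i ∈ s, c i • β i) (∏ i ∈ s, (linRat (β i))⁻¹)) =
      if 0 ≤ ∑ i ∈ s with β i k ≠ 0, c i * β i k then
        ∑ j ∈ s with β j k ≠ 0, (β j k)⁻¹ • Finsupp.single
          (∑ i ∈ s.erase j, c i • pivotMatrix β j k i)
          (∏ i ∈ s.erase j, (linRat (pivotMatrix β j k i))⁻¹)
      else 0 := by
  classical
  set μ := ∑ i ∈ s, c i • β i with hμ
  have hμk : μ k = ∑ i ∈ s with β i k ≠ 0, c i * β i k := by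
    rw [hμ, Finset.sum_apply, Finset.sum_filter]
    refine Finset.sum_congr rfl fun i _ => ?_
    by_cases h : β i k = 0 <;> simp [h]
  rw [resPlus_single, hμk]
  split_ifs with h0
  swap
  · rfl
  set A := s.filter fun i => β i k ≠ 0 with hA
  set l : Fin r → Fin r → ℝ := fun j => Pi.single k 1 - (β j k)⁻¹ • β j with hl
  have hAk : ∀ j ∈ A, β j k ≠ 0 := fun j hj => (Finset.mem_filter.mp hj).2
  have hl0 : ∀ j ∈ A, l j k = 0 := by
    intro j hj
    simp [hl, hAk j hj]
  have hsub : ∀ j ∈ A, ∀ b : Fin r → ℝ, substForm k (l j) b = b - (b k / β j k) • β j := by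
    intro j hj b
    have h : l j - Pi.single k 1 = -((β j k)⁻¹ • β j) := sub_sub_cancel_left _ _
    rw [substForm_eq k _ b (hl0 j hj), h, smul_neg, smul_smul, ← div_eq_mul_inv, ← sub_eq_add_neg]
  -- By independence the reduced forms are non-zero; hence the poles `l j` are distinct and simple.
  have hrow : ∀ i j, β j k ≠ 0 → i ≠ j → pivotMatrix β j k i ≠ 0 := by
    intro i j hj hij h
    apply hdet
    rw [← det_pivotMatrix_mul β j k hj,
      Matrix.det_eq_zero_of_row_eq_zero i (fun m => congrFun h m), zero_mul]
  have hβ0 : ∀ i, β i ≠ 0 := fun i h =>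
    hdet (Matrix.det_eq_zero_of_row_eq_zero i fun m => congrFun h m)
  have hlinj : Set.InjOn l A := by
    intro i hi j hj hij
    by_contra hne
    apply hrow i j (hAk j hj) hne
    rw [pivotMatrix_of_ne β k hne, ← hsub j hj, ← hij, hsub i hi, div_self (hAk i hi), one_smul,
      sub_self]
  rw [resInfty_eq_sum k μ _ (A.image l), Finset.sum_image hlinj]
  · refine Finset.sum_congr rfl fun j hj => ?_
    have hjs : j ∈ s := (Finset.mem_filter.mp hj).1
    rw [residueAt_prod_inv (hl0 j hj) _ s β hjs, Finsupp.smul_single]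
    · congr 2
      · rw [hsub j hj, hμ, Finset.sum_apply, ← Finset.add_sum_erase s _ hjs,
          ← Finset.add_sum_erase s (fun i => (c i • β i) k) hjs]
        have : ∀ i ∈ s.erase j, c i • pivotMatrix β j k i =
            c i • β i - ((c i • β i) k / β j k) • β j := by
          intro i hi
          rw [pivotMatrix_of_ne β k (Finset.ne_of_mem_erase hi), smul_sub, smul_smul,
            Pi.smul_apply, smul_eq_mul, mul_div_assoc]
        rw [Finset.sum_congr rfl this, Finset.sum_sub_distrib, ← Finset.sum_smul,
          ← Finset.sum_div, add_div, add_smul, Pi.smul_apply, smul_eq_mul,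
          mul_div_cancel_right₀ _ (hAk j hj)]
        abel
      · refine Finset.prod_congr rfl fun i hi => ?_
        rw [hsub j hj, pivotMatrix_of_ne β k (Finset.ne_of_mem_erase hi)]
    · rw [hsub j hj, div_self (hAk j hj), one_smul, sub_self]
    · intro i hi
      have hne := Finset.ne_of_mem_erase hi
      rw [hsub j hj, ← pivotMatrix_of_ne β k hne]
      exact hrow i j (hAk j hj) hne
  · intro l' hl'
    obtain ⟨j, hj, rfl⟩ := Finset.mem_image.mp hl'
    exact hl0 j hj
  -- A form involving `x_k` vanishes only at its own `l i`, and a form without `x_k` vanishes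
  -- nowhere, so there are no further poles.
  · intro l' hl' hnot
    refine residueAt_eq_zero hl' ?_ _ (prod_linRat_inv_mem s β)
    rintro _ ⟨i, hi, rfl⟩ h
    rw [substForm_eq k l' _ hl'] at h
    by_cases hik : β i k = 0
    · rw [hik, zero_smul, add_zero] at h
      exact hβ0 i h
    · apply hnot
      refine Finset.mem_image.mpr ⟨i, Finset.mem_filter.mpr ⟨hi, hik⟩, ?_⟩
      change Pi.single k 1 - (β i k)⁻¹ • β i = l'
      have h2 : (β i k)⁻¹ • β i = -(l' - Pi.single k 1) := by
        rw [inv_smul_eq_iff₀ hik, smul_neg]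
        exact eq_neg_of_add_eq_zero_left h
      rw [h2]
      abel

/-- Induction over the remaining coordinates. The set `s` holds the surviving forms, which involve
only coordinates in `ks`; each form already used is replaced by a unit row for the coordinate it
eliminated. This keeps the matrix square and invertible throughout, and the determinant collects the
pivots. The coordinates must be taken in increasing order for the weights to match the lexicographic
order. -/
theorem resFold_basis (ks : List (Fin r)) (hks : ks.Pairwise (· < ·)) :
    ∀ (s : Finset (Fin r)) (β : Matrix (Fin r) (Fin r) ℝ),
      (∀ i ∈ s, ∀ j, j ∉ ks → β i j = 0) → (∀ i, i ∉ s → ∃ j, j ∉ ks ∧ β i = Pi.single j 1) →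
      β.det ≠ 0 → ∀ c : Fin r → ℝ, (∀ i ∈ s, c i ≠ 0) →
        resFold ks (Finsupp.single (∑ i ∈ s, c i • β i) (∏ i ∈ s, (linRat (β i))⁻¹)) =
          constExpRat (|β.det|⁻¹ * ∏ i ∈ s, lexWeight (β i) (c i)) := by
  classical
  induction ks with
  | nil =>
    intro s β h1 h2 hdet c _
    have hs : s = ∅ := by
      rw [Finset.eq_empty_iff_forall_notMem]
      intro i hi
      exact hdet (Matrix.det_eq_zero_of_row_eq_zero i fun j => h1 i hi j (by simp))
    subst hs
    rw [abs_det_of_rows_single β hdet fun i => by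
      obtain ⟨j, -, hj⟩ := h2 i (by simp)
      exact ⟨j, hj⟩]
    simp [resFold, constExpRat]
  | cons k ks ih =>
    intro s β h1 h2 hdet c hc
    obtain ⟨hk, hks'⟩ := List.pairwise_cons.mp hks
    have hkks : k ∉ ks := fun h => lt_irrefl k (hk k h)
    have hout : ∀ i, i ∉ s → β i k = 0 := by
      intro i hi
      obtain ⟨j, hj, hij⟩ := h2 i hi
      have : k ≠ j := by
        rintro rfl
        simp at hj
      rw [hij, Pi.single_eq_of_ne this]
    have hAne : (s.filter fun i => β i k ≠ 0).Nonempty := by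
      by_contra hcon
      rw [Finset.not_nonempty_iff_eq_empty, Finset.filter_eq_empty_iff] at hcon
      apply hdet
      refine Matrix.det_eq_zero_of_column_eq_zero k fun i => ?_
      by_cases hi : i ∈ s
      · exact not_not.mp (hcon hi)
      · exact hout i hi
    have hlt : ∀ i ∈ s, ∀ j < k, β i j = 0 := by
      intro i hi j hj
      apply h1 i hi
      rw [List.mem_cons, not_or]
      exact ⟨hj.ne, fun h => lt_asymm hj (hk j h)⟩
    rw [resFold_cons, resPlus_prod_inv k s β hdet c]
    have hAs : ∀ j ∈ s.filter (fun i => β i k ≠ 0), j ∈ s ∧ β j k ≠ 0 := fun j hj =>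
      Finset.mem_filter.mp hj
    -- Only the forms involving `x_k` enter the combinatorial identity; the others pass unchanged
    -- through the substitution.
    rw [← Finset.prod_filter_mul_prod_filter_not s (fun i => β i k ≠ 0)
        (fun i => lexWeight (β i) (c i)),
      ← sum_lexWeight k (s.filter fun i => β i k ≠ 0) hAne β
        (fun i hi => hlt i (hAs i hi).1) (fun i hi => (hAs i hi).2)
        (fun i hi j hj hij h => hdet (by
          rw [← pivotMatrix_of_ne β k hij] at h
          rw [← det_pivotMatrix_mul β j k (hAs j hj).2,
            Matrix.det_eq_zero_of_row_eq_zero i (fun m => congrFun h m), zero_mul]))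
        c (fun i hi => hc i (hAs i hi).1)]
    split_ifs with h0
    swap
    · simp [constExpRat]
    rw [map_sum, Finset.sum_mul, Finset.mul_sum, ← constExpRat_sum]
    refine Finset.sum_congr rfl fun j hj => ?_
    obtain ⟨hjs, hjk⟩ := hAs j hj
    have hdetj := det_pivotMatrix_mul β j k hjk
    rw [map_smul, ih hks' (s.erase j) (pivotMatrix β j k), smul_constExpRat]
    · congr 1
      have hp : ∏ i ∈ s.erase j, lexWeight (pivotMatrix β j k i) (c i) =
          (∏ i ∈ (s.filter fun i => β i k ≠ 0).erase j,
            lexWeight (β i - (β i k / β j k) • β j) (c i)) *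
          ∏ i ∈ s with ¬ β i k ≠ 0, lexWeight (β i) (c i) := by
        rw [← Finset.prod_filter_mul_prod_filter_not (s.erase j) (fun i => β i k ≠ 0),
          Finset.filter_erase, Finset.filter_erase,
          Finset.erase_eq_of_notMem (s := s.filter fun i => ¬ β i k ≠ 0)
            (by simp [hjk])]
        congr 1
        · refine Finset.prod_congr rfl fun i hi => ?_
          rw [pivotMatrix_of_ne β k (Finset.ne_of_mem_erase hi)]
        · refine Finset.prod_congr rfl fun i hi => ?_
          have hik : β i k = 0 := not_not.mp (Finset.mem_filter.mp hi).2
          rw [pivotMatrix_of_ne β k (by rintro rfl; exact hjk hik), hik, zero_div, zero_smul,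
            sub_zero]
      -- The residue contributes `1 / β j k`, while the absolute determinants differ by `|β j k|`;
      -- the sign that remains is the one in `sum_lexWeight`.
      have hsgn : (β j k)⁻¹ * |(pivotMatrix β j k).det|⁻¹ =
          |β.det|⁻¹ * (SignType.sign (β j k) : ℝ) := by
        rw [← hdetj, abs_mul, mul_inv]
        have h6 : (β j k)⁻¹ = |β j k|⁻¹ * (SignType.sign (β j k) : ℝ) := by
          rcases hjk.lt_or_gt with h | h
          · rw [sign_neg h, abs_of_neg h, inv_neg, SignType.coe_neg_one, neg_mul_neg, mul_one]
          · rw [sign_pos h, abs_of_pos h, SignType.coe_one, mul_one]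
        rw [h6]
        ring
      rw [hp, ← mul_assoc, hsgn]
      ring
    · intro i hi m hm
      obtain ⟨hij, his⟩ := Finset.mem_erase.mp hi
      rw [pivotMatrix_of_ne β k hij, Pi.sub_apply, Pi.smul_apply, smul_eq_mul]
      by_cases hmk : m = k
      · subst hmk
        rw [div_mul_cancel₀ _ hjk, sub_self]
      · have hm' : m ∉ k :: ks := by simp [hmk, hm]
        rw [h1 i his m hm', h1 j hjs m hm', mul_zero, sub_zero]
    · intro i hi
      by_cases hij : i = j
      · subst hij
        exact ⟨k, hkks, pivotMatrix_self β i k⟩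
      · have his : i ∉ s := fun h => hi (Finset.mem_erase.mpr ⟨hij, h⟩)
        obtain ⟨m, hm, hm'⟩ := h2 i his
        refine ⟨m, fun h => hm (List.mem_cons_of_mem _ h), ?_⟩
        rw [pivotMatrix_of_ne β k hij, hout i his, zero_div, zero_smul, sub_zero, hm']
    · intro h
      rw [h, zero_mul] at hdetj
      exact hdet hdetj.symm
    · exact fun i hi => hc i (Finset.mem_of_mem_erase hi)

end Iterated

section Decomposition

variable {V : Type*} [AddCommGroup V] [Module ℝ V] {n r : ℕ}
  (y : Module.Basis (Fin r) ℝ (Module.Dual ℝ V)) (α : Fin n → Module.Dual ℝ V)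

/-! ### Partial fractions -/

/-- An element of `V*` as a rational function. -/
def formRat : Module.Dual ℝ V →ₗ[ℝ] RatFun r :=
  linRat ∘ₗ y.equivFun.toLinearMap

theorem formRat_apply (β : Module.Dual ℝ V) : formRat y β = linRat (y.equivFun β) := rfl

theorem algebraMap_linForm (β : Module.Dual ℝ V) :
    algebraMap (Poly r) (RatFun r) (linForm y β) = formRat y β := rfl

theorem formRat_ne_zero {β : Module.Dual ℝ V} (hβ : β ≠ 0) : formRat y β ≠ 0 := by
  rw [formRat_apply, Ne, linRat_eq_zero_iff]
  simpa using hβ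

theorem linForm_basis (k : Fin r) : linForm y (y k) = MvPolynomial.X k := by
  rw [linForm, ← linPoly_single]
  congr 1
  ext j
  rw [y.repr_self, Finsupp.single_eq_pi_single]

theorem isHomogeneous_linForm (β : Module.Dual ℝ V) : (linForm y β).IsHomogeneous 1 :=
  isHomogeneous_linPoly _

theorem frac_eq (P : Poly r) (m : Fin n → ℕ) :
    frac y α P m = algebraMap (Poly r) (RatFun r) P * (∏ i, formRat y (α i) ^ m i)⁻¹ :=
  div_eq_mul_inv _ _

/-- `P ↦ P / ∏ α_i ^ m_i` as a linear map. -/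
def fracLin (m : Fin n → ℕ) : Poly r →ₗ[ℝ] RatFun r :=
  LinearMap.mulRight ℝ (∏ i, formRat y (α i) ^ m i)⁻¹ ∘ₗ
    (Algebra.linearMap (Poly r) (RatFun r)).restrictScalars ℝ

theorem fracLin_apply (P : Poly r) (m : Fin n → ℕ) : fracLin y α m P = frac y α P m := by
  rw [frac_eq]; rfl

theorem frac_mul (P Q : Poly r) (m : Fin n → ℕ) :
    frac y α (P * Q) m = algebraMap (Poly r) (RatFun r) P * frac y α Q m := by
  rw [frac_eq, frac_eq, map_mul, mul_assoc]

variable {α}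

theorem formRat_mul_frac (hα : ∀ i, α i ≠ 0) (P : Poly r) (m : Fin n → ℕ) {i : Fin n}
    (hi : 0 < m i) : formRat y (α i) * frac y α P m = frac y α P (m - Pi.single i 1) := by
  rw [frac_eq, frac_eq, mul_left_comm]
  congr 1
  conv_rhs => rw [← Finset.mul_prod_erase _ _ (Finset.mem_univ i)]
  rw [← Finset.mul_prod_erase _ (fun j => formRat y (α j) ^ m j) (Finset.mem_univ i),
    mul_inv, mul_inv, ← mul_assoc]
  congr 1
  · have h0 := formRat_ne_zero y (hα i)
    obtain ⟨t, ht⟩ := Nat.exists_eq_add_of_lt hi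
    rw [zero_add] at ht
    rw [Pi.sub_apply, Pi.single_eq_same, ht, Nat.add_sub_cancel, pow_succ, mul_inv, mul_comm,
      mul_assoc, inv_mul_cancel₀ h0, mul_one]
  · congr 1
    refine Finset.prod_congr rfl fun j hj => ?_
    rw [Pi.sub_apply, Pi.single_eq_of_ne (Finset.ne_of_mem_erase hj), Nat.sub_zero]

variable (α)

/-- `{i | 0 < m i}` indexes a basis of `V*`. -/
def HasBasisSupport (m : Fin n → ℕ) : Prop :=
  ∃ s : Fin r → Fin n, IsBasisFamily (fun k => α (s k)) ∧ {i | 0 < m i} = Set.range s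

/-- The span of the `1 / ∏ α_i ^ m_i` with `∑ m_i = N - p` such that `{i | m_i > 0}` indexes a
basis and is contained in `S`. -/
def basisPart (S : Set (Fin n)) (p N : ℕ) : Submodule ℝ (RatFun r) :=
  Submodule.span ℝ {f | ∃ m : Fin n → ℕ, HasBasisSupport (r := r) α m ∧ {i | 0 < m i} ⊆ S ∧
    ∑ i, m i + p = N ∧ f = frac y α 1 m}

variable {α}

theorem sum_sub_single (m : Fin n → ℕ) {i : Fin n} (hi : 0 < m i) (S : Finset (Fin n))
    (hS : i ∈ S) : ∑ j ∈ S, (m - Pi.single i 1 : Fin n → ℕ) j + 1 = ∑ j ∈ S, m j := by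
  rw [← Finset.add_sum_erase S _ hS, ← Finset.add_sum_erase S (fun j => m j) hS, Pi.sub_apply,
    Pi.single_eq_same]
  have : ∑ j ∈ S.erase i, (m - Pi.single i 1 : Fin n → ℕ) j = ∑ j ∈ S.erase i, m j :=
    Finset.sum_congr rfl fun j hj => by
      rw [Pi.sub_apply, Pi.single_eq_of_ne (Finset.ne_of_mem_erase hj), Nat.sub_zero]
  rw [this]
  omega

theorem pos_of_sub_single_pos {m : Fin n → ℕ} {i j : Fin n} 
    (h : 0 < (m - Pi.single i 1 : Fin n → ℕ) j) :
    0 < m j := lt_of_lt_of_le h (Nat.sub_le _ _)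

theorem exists_of_basis_finset (y : Module.Basis (Fin r) ℝ (Module.Dual ℝ V)) (T : Finset (Fin n))
    (hT : IsBasisFamily fun i : T => α i) :
    ∃ e : Fin r ≃ T, IsBasisFamily fun k => α (e k) := by
  have hcard : Fintype.card T = Fintype.card (Fin r) := by
    let b := Module.Basis.mk hT.1 hT.2.ge
    rw [← Module.finrank_eq_card_basis b, ← Module.finrank_eq_card_basis y]
  let e : Fin r ≃ T := (Fintype.equivOfCardEq hcard).symm
  refine ⟨e, hT.1.comp e e.injective, ?_⟩
  rw [← hT.2]
  congr 1
  exact e.surjective.range_comp (fun i : T => α i)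

/-- Partial fractions with constant numerators. -/
theorem frac_one_mem (hα : ∀ i, α i ≠ 0) (S : Set (Fin n)) (d : ℕ) :
    ∀ (N : ℕ) (m : Fin n → ℕ), (Finset.univ.filter fun i => 0 < m i).card = N →
      {i | 0 < m i} ⊆ S → ∑ i, m i = d →
        frac y α 1 m ∈ nonGenPart y α ⊔ basisPart y α S 0 d := by
  intro N
  induction N using Nat.strong_induction_on with
  | _ N ihN =>
    intro m hN hS hd
    set T := Finset.univ.filter fun i => 0 < m i with hT
    have hTcoe : {i | 0 < m i} = (T : Set (Fin n)) := by ext; simp [hT]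
    by_cases hgen : IsGenerating α {i | 0 < m i}
    swap
    · exact Submodule.mem_sup_left (Submodule.subset_span ⟨1, m, hgen, rfl⟩)
    by_cases hind : LinearIndependent ℝ fun i : T => α i
    · obtain ⟨e, he⟩ := exists_of_basis_finset y T ⟨hind, by
        rw [← hgen, hTcoe, Set.image_eq_range]; rfl⟩
      refine Submodule.mem_sup_right (Submodule.subset_span ⟨m, ⟨fun k => e k, he, ?_⟩, hS, hd, rfl⟩)
      rw [hTcoe]
      exact (Subtype.range_coe.symm.trans
        (e.surjective.range_comp (fun i : T => (i : Fin n))).symm)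
    · obtain ⟨g, hg, j, hj⟩ := Fintype.not_linearIndependent_iff.mp hind
      have hrel : α j = ∑ i ∈ Finset.univ.erase j, (-(g i) / g j) • α i := by
        have h1 : g j • α j = -∑ i ∈ Finset.univ.erase j, g i • α i := by
          rw [eq_neg_iff_add_eq_zero, Finset.add_sum_erase _ (fun i : T => g i • α i)
            (Finset.mem_univ j), hg]
        rw [← inv_smul_smul₀ hj (α j), h1, ← Finset.sum_neg_distrib, Finset.smul_sum]
        refine Finset.sum_congr rfl fun i _ => ?_
        ext v
        simp only [LinearMap.smul_apply, LinearMap.neg_apply, smul_eq_mul]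
        ring
      -- Inner induction on the total exponent away from `j`, for a fixed relation expressing `α j`.
      -- Multiplying by `α j / α j` and expanding the numerator moves one exponent from some `i` to
      -- `j`. Once a factor disappears, the outer induction on the number of distinct factors
      -- applies.
      suffices H : ∀ (M : ℕ) (m' : Fin n → ℕ), (∀ i, 0 < m' i → i ∈ T) → ∑ i, m' i = d →
          ∑ i ∈ T.erase j, m' i = M →
          frac y α 1 m' ∈ nonGenPart y α ⊔ basisPart y α S 0 d from
        H _ m (fun i hi => by simpa [hT] using hi) hd rfl
      intro M
      induction M using Nat.strong_induction_on with
      | _ M ihM =>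
        intro m' hm'T hm'd hM
        by_cases hsub : (Finset.univ.filter fun i => 0 < m' i) = T
        swap
        · have hss : (Finset.univ.filter fun i => 0 < m' i) ⊂ T :=
            lt_of_le_of_ne (fun i hi => hm'T i (by simpa using hi)) hsub
          refine ihN _ (hN ▸ Finset.card_lt_card hss) m' rfl (fun i hi => hS ?_) hm'd
          rw [hTcoe]
          exact hm'T i hi
        · have hpos : ∀ i ∈ T, 0 < m' i := fun i hi => by
            rw [← hsub] at hi
            simpa using hi
          set m'' := m' + Pi.single (j : Fin n) 1 with hm''
          have hback : m'' - Pi.single (j : Fin n) 1 = m' := by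
            ext i; simp [hm'']
          have hj'' : 0 < m'' j := by simp [hm'']
          rw [← hback, ← formRat_mul_frac y hα 1 m'' hj'', hrel, map_sum, Finset.sum_mul]
          refine Submodule.sum_mem _ fun i hi => ?_
          have hij : (i : Fin n) ≠ j := fun h => Finset.ne_of_mem_erase hi (Subtype.ext h)
          have hi'' : 0 < m'' i := by
            have := hpos i i.2
            simp only [hm'', Pi.add_apply]
            omega
          rw [map_smul, smul_mul_assoc, formRat_mul_frac y hα 1 m'' hi'']
          refine Submodule.smul_mem _ _ (ihM (∑ a ∈ T.erase j,
            (m'' - Pi.single (i : Fin n) 1 : Fin n → ℕ) a) ?_ _ ?_ ?_ rfl)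
          · have h1 := sum_sub_single m'' hi'' (T.erase j) (Finset.mem_erase.mpr ⟨hij, i.2⟩)
            have h2 : ∑ a ∈ T.erase j, m'' a = ∑ a ∈ T.erase j, m' a :=
              Finset.sum_congr rfl fun a ha => by
                simp [hm'', Pi.single_eq_of_ne (Finset.ne_of_mem_erase ha)]
            omega
          · intro a ha
            have ha' := pos_of_sub_single_pos ha
            by_cases haj : a = j
            · exact haj ▸ j.2
            · apply hm'T
              simpa [hm'', Pi.single_eq_of_ne haj] using ha'
          · have h1 := sum_sub_single m'' hi'' Finset.univ (Finset.mem_univ _)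
            have h2 := sum_sub_single m'' hj'' Finset.univ (Finset.mem_univ _)
            rw [hback] at h2
            omega

/-- Partial fractions for monomial numerators. -/
theorem frac_monomial_mem (hα : ∀ i, α i ≠ 0) (S : Set (Fin n)) (p : ℕ) :
    ∀ (e : Fin r →₀ ℕ), e.degree = p → ∀ (N : ℕ) (m : Fin n → ℕ), {i | 0 < m i} ⊆ S →
      ∑ i, m i = N → frac y α (MvPolynomial.monomial e 1) m ∈
        nonGenPart y α ⊔ basisPart y α S p N := by
  induction p with
  | zero =>
    intro e he N m hS hN
    rw [Finsupp.degree_eq_zero_iff] at he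
    rw [he]
    exact frac_one_mem y hα S N _ m rfl hS hN
  | succ p ih =>
    intro e he N m hS hN
    by_cases hgen : IsGenerating α {i | 0 < m i}
    swap
    · exact Submodule.mem_sup_left (Submodule.subset_span ⟨_, m, hgen, rfl⟩)
    obtain ⟨k, hk⟩ : ∃ k, e k ≠ 0 := by
      by_contra! h
      rw [show e = 0 from Finsupp.ext h] at he
      simp at he
    obtain ⟨e', rfl⟩ : ∃ e', e = Finsupp.single k 1 + e' :=
      ⟨e - Finsupp.single k 1, (add_tsub_cancel_of_le
        (Finsupp.single_le_iff.mpr (Nat.one_le_iff_ne_zero.mpr hk))).symm⟩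
    have he' : e'.degree = p := by
      rw [map_add, Finsupp.degree_single] at he
      omega
    -- The denominators span, so the coordinate `y k` in the numerator is a combination of them and
    -- each term cancels one factor.
    have hyk : y k ∈ Submodule.span ℝ (α '' {i | 0 < m i}) := by
      rw [hgen]; trivial
    rw [MvPolynomial.monomial_single_add, pow_one, frac_mul, ← linForm_basis y k,
      algebraMap_linForm]
    suffices H : ∀ β ∈ Submodule.span ℝ (α '' {i | 0 < m i}),
        formRat y β * frac y α (MvPolynomial.monomial e' 1) m ∈
          nonGenPart y α ⊔ basisPart y α S (p + 1) N from H _ hyk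
    intro β hβ
    induction hβ using Submodule.span_induction with
    | mem β hβ =>
      obtain ⟨i, hi, rfl⟩ := hβ
      rw [formRat_mul_frac y hα _ m hi]
      have hsum := sum_sub_single m hi Finset.univ (Finset.mem_univ i)
      have h1 := ih e' he' (N - 1) (m - Pi.single i 1)
        (fun j hj => hS (pos_of_sub_single_pos hj)) (by omega)
      have hle : basisPart y α S p (N - 1) ≤ basisPart y α S (p + 1) N := by
        refine Submodule.span_mono ?_
        rintro f ⟨m', h1, h2, h3, h4⟩
        exact ⟨m', h1, h2, by omega, h4⟩
      exact sup_le_sup_left hle (nonGenPart y α) h1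
    | zero => rw [map_zero, zero_mul]; exact Submodule.zero_mem _
    | add β γ _ _ h1 h2 => rw [map_add, add_mul]; exact Submodule.add_mem _ h1 h2
    | smul c β _ h1 => rw [map_smul, smul_mul_assoc]; exact Submodule.smul_mem _ _ h1

/-- Partial fractions for homogeneous numerators. -/
theorem frac_homogeneous_mem (hα : ∀ i, α i ≠ 0) (S : Set (Fin n)) {p N : ℕ} {P : Poly r}
    (hP : P.IsHomogeneous p) {m : Fin n → ℕ} (hS : {i | 0 < m i} ⊆ S) (hN : ∑ i, m i = N) :
    frac y α P m ∈ nonGenPart y α ⊔ basisPart y α S p N := by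
  rw [P.as_sum, ← fracLin_apply, map_sum]
  refine Submodule.sum_mem _ fun e he => ?_
  rw [← mul_one (P.coeff e), ← smul_eq_mul, ← MvPolynomial.smul_monomial, map_smul]
  refine Submodule.smul_mem _ _ ?_
  rw [fracLin_apply]
  refine frac_monomial_mem y hα S p e ?_ N m hS hN
  rw [Finsupp.degree_eq_weight_one]
  exact hP (MvPolynomial.mem_support_iff.mp he)

/-- Partial fractions without control of the degrees. -/
theorem frac_mem_span (hα : ∀ i, α i ≠ 0) (S : Set (Fin n)) (P : Poly r) {m : Fin n → ℕ}
    (hS : {i | 0 < m i} ⊆ S) :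
    frac y α P m ∈ nonGenPart y α ⊔ Submodule.span ℝ {f | ∃ m : Fin n → ℕ,
      HasBasisSupport (r := r) α m ∧ {i | 0 < m i} ⊆ S ∧ f = frac y α 1 m} := by
  rw [← MvPolynomial.sum_homogeneousComponent P, ← fracLin_apply, map_sum]
  refine Submodule.sum_mem _ fun p _ => ?_
  rw [fracLin_apply]
  have hle : basisPart y α S p (∑ i, m i) ≤ Submodule.span ℝ {f | ∃ m : Fin n → ℕ,
      HasBasisSupport (r := r) α m ∧ {i | 0 < m i} ⊆ S ∧ f = frac y α 1 m} := by
    refine Submodule.span_mono ?_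
    rintro f ⟨m', h1, h2, -, h4⟩
    exact ⟨m', h1, h2, h4⟩
  exact sup_le_sup_left hle (nonGenPart y α) (frac_homogeneous_mem y hα S
    (MvPolynomial.homogeneousComponent_isHomogeneous p P) hS rfl)

end Decomposition

/-! ### Values of `JK_ε` and of the iterated residue on partial fractions -/

section Functional

variable {V : Type*} [AddCommGroup V] [Module ℝ V] {n r : ℕ}
  {B : LinearMap.BilinForm ℝ (Module.Dual ℝ V)}
  {y : Module.Basis (Fin r) ℝ (Module.Dual ℝ V)} {α : Fin n → Module.Dual ℝ V}
  {ε : Module.Dual ℝ V}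

/-! ### Cones and regularity -/

theorem mem_cone_range_iff {ι : Type*} [Fintype ι] (s : ι → Fin n) (β : Module.Dual ℝ V) :
    β ∈ cone α (Set.range s) ↔ ∃ c : ι → ℝ, (∀ k, 0 ≤ c k) ∧ β = ∑ k, c k • α (s k) := by
  have h : α '' Set.range s = Set.range fun k => α (s k) := (Set.range_comp α s).symm
  rw [cone, h, SetLike.mem_coe, Submodule.mem_span_range_iff_exists_fun]
  constructor
  · rintro ⟨c, rfl⟩
    exact ⟨fun k => c k, fun k => (c k).2, rfl⟩
  · rintro ⟨c, hc, rfl⟩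
    exact ⟨fun k => ⟨c k, hc k⟩, rfl⟩

theorem cone_mono {S T : Set (Fin n)} (h : S ⊆ T) : cone α S ⊆ cone α T :=
  Submodule.span_mono (Set.image_mono h)

theorem IsRegular.notMem_span (hε : IsRegular α ε) (y : Module.Basis (Fin r) ℝ (Module.Dual ℝ V))
    {S : Set (Fin n)} (hS : ¬ IsGenerating α S) : ε ∉ Submodule.span ℝ (α '' S) := by
  have : Module.Finite ℝ (Module.Dual ℝ V) := Module.Finite.of_basis y
  exact hε S (Submodule.finrank_lt hS)

/-- The coordinates of a regular vector in a basis contained in the arrangement. -/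
theorem IsRegular.exists_coeff (hε : IsRegular α ε)
    (y : Module.Basis (Fin r) ℝ (Module.Dual ℝ V)) {ι : Type*} [Fintype ι] {s : ι → Fin n}
    (hs : IsBasisFamily fun k => α (s k)) :
    ∃ c : ι → ℝ, (∀ k, c k ≠ 0) ∧ ε = ∑ k, c k • α (s k) ∧
      (ε ∈ cone α (Set.range s) ↔ ∀ k, 0 < c k) := by
  classical
  have hmem : ε ∈ Submodule.span ℝ (Set.range fun k => α (s k)) := hs.2 ▸ Submodule.mem_top
  obtain ⟨c, hc⟩ := (Submodule.mem_span_range_iff_exists_fun ℝ).mp hmem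
  have hc0 : ∀ k, c k ≠ 0 := by
    intro k hk
    -- A zero coefficient would put `ε` in the span of the other basis vectors, against regularity.
    have hng : ¬ IsGenerating α (s '' {k}ᶜ) := by
      intro hgen
      have h1 : α (s k) ∈ Submodule.span ℝ (α '' (s '' {k}ᶜ)) := by
        rw [hgen]; exact Submodule.mem_top
      rw [← Set.image_comp] at h1
      exact hs.1.notMem_span_image (s := {k}ᶜ) (x := k) (by simp) h1
    apply hε.notMem_span y hng
    rw [← hc]
    refine Submodule.sum_mem _ fun i _ => ?_
    by_cases hik : i = k
    · rw [hik, hk, zero_smul]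
      exact Submodule.zero_mem _
    · exact Submodule.smul_mem _ _ (Submodule.subset_span ⟨s i, ⟨i, hik, rfl⟩, rfl⟩)
  refine ⟨c, hc0, hc.symm, ?_⟩
  rw [mem_cone_range_iff]
  constructor
  · rintro ⟨d, hd, hd'⟩ k
    have h2 : ∀ k, c k - d k = 0 := Fintype.linearIndependent_iff.mp hs.1 _ (by
      simp only [sub_smul, Finset.sum_sub_distrib]
      rw [hc, hd', sub_self])
    exact lt_of_le_of_ne ((sub_eq_zero.mp (h2 k)) ▸ hd k) (hc0 k).symm
  · intro h
    exact ⟨c, fun k => (h k).le, hc.symm⟩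

/-! ### Gram determinants -/

/-- The Gram matrix transforms as `M G Mᵀ`. This converts `|det β|⁻¹` together with the
normalisation by the basis `x` into the Gram determinant of `β`. -/
theorem gramDet_eq_det_sq_mul (B : LinearMap.BilinForm ℝ (Module.Dual ℝ V))
    (x : Module.Basis (Fin r) ℝ (Module.Dual ℝ V)) (β : Fin r → Module.Dual ℝ V) :
    gramDet B β =
      (Matrix.of fun k => x.equivFun (β k) : Matrix (Fin r) (Fin r) ℝ).det ^ 2 *
        gramDet B fun k => x k := by
  have h : (Matrix.of fun i j => B (β i) (β j)) =
      (Matrix.of fun k => x.equivFun (β k) : Matrix (Fin r) (Fin r) ℝ) *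
        (Matrix.of fun i j => B (x i) (x j)) *
        (Matrix.of fun k => x.equivFun (β k) : Matrix (Fin r) (Fin r) ℝ).transpose := by
    ext i j
    simp only [Matrix.of_apply, Matrix.mul_apply, Matrix.transpose_apply]
    conv_lhs => rw [← x.sum_equivFun (β i), ← x.sum_equivFun (β j)]
    simp only [map_sum, LinearMap.sum_apply, map_smul, LinearMap.smul_apply, smul_eq_mul]
    refine Finset.sum_congr rfl fun a _ => ?_
    rw [Finset.sum_mul]
    rw [Finset.mul_sum]
    refine Finset.sum_congr rfl fun b _ => ?_
    ring
  rw [gramDet, h, Matrix.det_mul, Matrix.det_mul, Matrix.det_transpose, gramDet]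
  ring

theorem gramDet_pos (hB : IsScalarProduct B) {ι : Type*} [Fintype ι] [DecidableEq ι]
    {β : ι → Module.Dual ℝ V} (hβ : LinearIndependent ℝ β) : 0 < gramDet B β := by
  apply Matrix.PosDef.det_pos
  refine Matrix.PosDef.of_dotProduct_mulVec_pos ?_ ?_
  · ext i j
    simp [hB.1 (β i) (β j)]
  · intro v hv
    have h1 : ∑ i, v i • β i ≠ 0 := fun h =>
      hv (funext fun i => Fintype.linearIndependent_iff.mp hβ v h i)
    have h2 := hB.2 _ h1
    suffices key : dotProduct (star v) ((Matrix.of fun i j => B (β i) (β j)).mulVec v) =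
        B (∑ i, v i • β i) (∑ i, v i • β i) from key ▸ h2
    simp only [map_sum, LinearMap.sum_apply, map_smul, LinearMap.smul_apply, smul_eq_mul,
      dotProduct, Matrix.mulVec, Matrix.of_apply, star_trivial]
    refine Finset.sum_congr rfl fun a _ => ?_
    rw [Finset.mul_sum, Finset.mul_sum]
    refine Finset.sum_congr rfl fun b _ => ?_
    rw [hB.1 (β a) (β b)]
    ring

/-! ### The values of a functional `JK_ε` -/

/-- The `r` exponents on the support are at least `1` and sum to `r`, so all of them equal `1`. -/
theorem frac_eq_of_basisSupport {m : Fin n → ℕ} {s : Fin r → Fin n} (hs : Function.Injective s)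
    (hm : {i | 0 < m i} = Set.range s) (hr : ∑ i, m i = r) :
    frac y α 1 m = 1 / ∏ k, algebraMap (Poly r) (RatFun r) (linForm y (α (s k))) := by
  classical
  have hout : ∀ i, i ∉ Finset.univ.image s → m i = 0 := by
    intro i hi
    by_contra h
    have : i ∈ Set.range s := hm ▸ Nat.pos_of_ne_zero h
    simp at this hi
    exact this.elim hi
  have hsum : ∑ k, m (s k) = r := by
    refine Eq.trans ?_ hr
    rw [← Finset.sum_image (f := m) hs.injOn]
    exact Finset.sum_subset (Finset.subset_univ _) fun i _ hi => hout i hi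
  have hpos : ∀ k, 1 ≤ m (s k) := fun k => by
    have : s k ∈ {i | 0 < m i} := hm ▸ ⟨k, rfl⟩
    exact this
  have hone : ∀ k, m (s k) = 1 := by
    have h1 : ∑ k : Fin r, 1 = ∑ k, m (s k) := by simp [hsum]
    intro k
    exact ((Finset.sum_eq_sum_iff_of_le fun k _ => hpos k).mp h1 k (Finset.mem_univ k)).symm
  rw [frac, map_one]
  congr 1
  rw [← Finset.prod_subset (Finset.subset_univ (Finset.univ.image s)) fun i _ hi => by
    rw [hout i hi, pow_zero], Finset.prod_image hs.injOn]
  exact Finset.prod_congr rfl fun k _ => by rw [hone k, pow_one]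

open scoped Classical in
/-- The value of `JK_ε` on `1 / ∏ α_{s_k}`. -/
def jkValue (B : LinearMap.BilinForm ℝ (Module.Dual ℝ V)) (α : Fin n → Module.Dual ℝ V)
    (ε : Module.Dual ℝ V) (s : Fin r → Fin n) : ℝ :=
  if ε ∈ cone α (Set.range s) then 1 / Real.sqrt (gramDet B fun k => α (s k)) else 0

theorem IsBasisFamily.injective {s : Fin r → Fin n} (hs : IsBasisFamily fun k => α (s k)) :
    Function.Injective s := hs.1.injective.of_comp (f := α)

theorem IsJKFunctional.apply_frac {L : ratSpace y α →ₗ[ℝ] ℝ} (hL : IsJKFunctional B y α ε L)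
    {m : Fin n → ℕ} {s : Fin r → Fin n} (hs : IsBasisFamily fun k => α (s k))
    (hm : {i | 0 < m i} = Set.range s) (f : ratSpace y α) (hf : (f : RatFun r) = frac y α 1 m) :
    L f = if ∑ i, m i = r then jkValue B α ε s else 0 := by
  split_ifs with hr
  · exact hL.basis s hs f (hf.trans (frac_eq_of_basisSupport hs.injective hm hr))
  · refine hL.gen_of_ne _ hr f ?_
    rw [hf]
    refine Submodule.subset_span ⟨m, ?_, rfl, rfl⟩
    rw [hm, IsGenerating, ← hs.2, ← Set.range_comp]
    rfl

theorem nonGenPart_le_ratSpace : nonGenPart y α ≤ ratSpace y α := by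
  refine Submodule.span_le.mpr ?_
  rintro f ⟨P, m, -, rfl⟩
  exact frac_mem_ratSpace y α P m

/-- Linear maps on `R_𝔄` agreeing on `U` and on `span T` agree on `U ⊔ span T`. -/
theorem eq_on_sup_span {M : Type*} [AddCommGroup M] [Module ℝ M]
    (Φ Ψ : ratSpace y α →ₗ[ℝ] M) {U : Submodule ℝ (RatFun r)} {T : Set (RatFun r)}
    (hU : U ≤ ratSpace y α) (hT : T ⊆ ratSpace y α)
    (h1 : ∀ f : ratSpace y α, (f : RatFun r) ∈ U → Φ f = Ψ f)
    (h2 : ∀ f : ratSpace y α, (f : RatFun r) ∈ T → Φ f = Ψ f)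
    (f : ratSpace y α) (hf : (f : RatFun r) ∈ U ⊔ Submodule.span ℝ T) : Φ f = Ψ f := by
  have hle : U ⊔ Submodule.span ℝ T ≤ (LinearMap.eqLocus Φ Ψ).map (ratSpace y α).subtype := by
    refine sup_le (fun g hg => ?_) (Submodule.span_le.mpr fun g hg => ?_)
    · exact ⟨⟨g, hU hg⟩, h1 _ hg, rfl⟩
    · exact ⟨⟨g, hT hg⟩, h2 _ hg, rfl⟩
  obtain ⟨g, hg, hgf⟩ := hle hf
  rw [← Subtype.ext hgf]
  exact hg

theorem IsJKFunctional.unique (hα : ∀ i, α i ≠ 0) {L L' : ratSpace y α →ₗ[ℝ] ℝ}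
    (hL : IsJKFunctional B y α ε L) (hL' : IsJKFunctional B y α ε L') : L = L' := by
  ext f
  refine eq_on_sup_span L L' (U := nonGenPart y α) (T := {f | ∃ m : Fin n → ℕ,
      HasBasisSupport (r := r) α m ∧ {i | 0 < m i} ⊆ Set.univ ∧ f = frac y α 1 m})
    nonGenPart_le_ratSpace ?_ (fun f hf => ?_) ?_ f ?_
  · rintro f ⟨m, -, -, rfl⟩
    exact frac_mem_ratSpace y α 1 m
  · rw [hL.nonGen f hf, hL'.nonGen f hf]
  · rintro f ⟨m, ⟨s, hs, hm⟩, -, hf⟩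
    rw [hL.apply_frac hs hm f hf, hL'.apply_frac hs hm f hf]
  · have hle : ratSpace y α ≤ nonGenPart y α ⊔ Submodule.span ℝ {f | ∃ m : Fin n → ℕ,
      HasBasisSupport (r := r) α m ∧ {i | 0 < m i} ⊆ Set.univ ∧ f = frac y α 1 m} := by
      refine Submodule.span_le.mpr ?_
      rintro g ⟨P, m, rfl⟩
      exact frac_mem_span y hα Set.univ P (Set.subset_univ _)
    exact hle f.2

/-! ### Change of coordinates -/

theorem changeCoord_linForm (y x : Module.Basis (Fin r) ℝ (Module.Dual ℝ V))
    (β : Module.Dual ℝ V) : changeCoord y x (linForm y β) = linForm x β := by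
  have h : ∀ γ : Module.Dual ℝ V, linForm x γ = ∑ j, MvPolynomial.C (x.equivFun γ j) *
      MvPolynomial.X j := fun _ => rfl
  rw [changeCoord, linForm, linPoly, map_sum, h β]
  simp only [map_mul, MvPolynomial.aeval_X, MvPolynomial.aeval_C, MvPolynomial.algebraMap_eq]
  conv_rhs => rw [← y.sum_equivFun β]
  simp only [map_sum, map_smul, Finset.sum_apply, Pi.smul_apply, smul_eq_mul, Finset.sum_mul,
    map_mul]
  rw [Finset.sum_comm]
  refine Finset.sum_congr rfl fun i _ => ?_
  rw [h, Finset.mul_sum]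
  refine Finset.sum_congr rfl fun j _ => ?_
  rw [mul_assoc]
  rfl

theorem changeCoord_changeCoord (y x : Module.Basis (Fin r) ℝ (Module.Dual ℝ V)) (P : Poly r) :
    changeCoord x y (changeCoord y x P) = P := by
  have : ((MvPolynomial.aeval fun i => linForm y (x i)).comp
      (MvPolynomial.aeval fun i => linForm x (y i)) : Poly r →ₐ[ℝ] Poly r) = AlgHom.id ℝ _ := by
    apply MvPolynomial.algHom_ext
    intro i
    rw [AlgHom.comp_apply, MvPolynomial.aeval_X]
    exact (changeCoord_linForm x y (y i)).trans (linForm_basis y i)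
  exact DFunLike.congr_fun this P

theorem changeCoord_injective (y x : Module.Basis (Fin r) ℝ (Module.Dual ℝ V)) :
    Function.Injective (changeCoord y x) :=
  Function.LeftInverse.injective (changeCoord_changeCoord y x)

theorem algebraMap_changeCoord_injective (y x : Module.Basis (Fin r) ℝ (Module.Dual ℝ V)) :
    Function.Injective ((IsScalarTower.toAlgHom ℝ (Poly r) (RatFun r)).comp
      (MvPolynomial.aeval fun i => linForm x (y i))) :=
  Function.Injective.comp (g := algebraMap (Poly r) (RatFun r)) (f := changeCoord y x)
    (IsFractionRing.injective (Poly r) (RatFun r)) (changeCoord_injective y x)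

/-- The change of coordinates of rational functions. -/
def changeRat (y x : Module.Basis (Fin r) ℝ (Module.Dual ℝ V)) : RatFun r →ₐ[ℝ] RatFun r :=
  IsFractionRing.liftAlgHom (K := RatFun r) (algebraMap_changeCoord_injective y x)

theorem changeRat_algebraMap (y x : Module.Basis (Fin r) ℝ (Module.Dual ℝ V)) (P : Poly r) :
    changeRat y x (algebraMap (Poly r) (RatFun r) P) =
      algebraMap (Poly r) (RatFun r) (changeCoord y x P) :=
  IsFractionRing.lift_algebraMap (algebraMap_changeCoord_injective y x) P

theorem changeRat_frac (y x : Module.Basis (Fin r) ℝ (Module.Dual ℝ V)) (P : Poly r)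
    (m : Fin n → ℕ) : changeRat y x (frac y α P m) = frac x α (changeCoord y x P) m := by
  rw [frac, frac, map_div₀, map_prod, changeRat_algebraMap]
  simp only [map_pow, changeRat_algebraMap, changeCoord_linForm]

/-! ### The Jeffrey-Kirwan residue as a linear map -/

/-- `f ↦ JKRes^Λ (f e^ε)`. -/
def jkResLin (B : LinearMap.BilinForm ℝ (Module.Dual ℝ V))
    (y x : Module.Basis (Fin r) ℝ (Module.Dual ℝ V)) (ε : Module.Dual ℝ V) :
    RatFun r →ₗ[ℝ] ExpRat r :=
  (1 / Real.sqrt (gramDet B fun k => x k)) • (resFold (List.finRange r) ∘ₗ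
    Finsupp.lsingle (x.equivFun ε) ∘ₗ (changeRat y x).toLinearMap)

theorem jkResLin_apply (x : Module.Basis (Fin r) ℝ (Module.Dual ℝ V)) (f : RatFun r) :
    jkResLin B y x ε f = (1 / Real.sqrt (gramDet B fun k => x k)) • resFold (List.finRange r)
      (Finsupp.single (x.equivFun ε) (changeRat y x f)) := rfl

theorem JKRes_eq (x : Module.Basis (Fin r) ℝ (Module.Dual ℝ V)) (P : Poly r) :
    JKRes B y x α ε P = jkResLin B y x ε (frac y α P fun _ => 1) := by
  rw [jkResLin_apply, changeRat_frac, resFold_apply, frac]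
  simp only [pow_one]
  rfl

/-- Apply `resFold_eq_zero` with `W` the span of the denominators: it is proper, so the regular `ε`
lies outside it. The numerator is harmless, since polynomials have no poles. -/
theorem jkResLin_eq_zero (hα : ∀ i, α i ≠ 0) (hε : IsRegular α ε)
    (x : Module.Basis (Fin r) ℝ (Module.Dual ℝ V)) {f : RatFun r} (hf : f ∈ nonGenPart y α) :
    jkResLin B y x ε f = 0 := by
  suffices H : nonGenPart y α ≤ LinearMap.ker (jkResLin B y x ε) from H hf
  refine Submodule.span_le.mpr ?_
  rintro _ ⟨P, m, hm, rfl⟩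
  rw [SetLike.mem_coe, LinearMap.mem_ker, jkResLin_apply, changeRat_frac]
  rw [resFold_eq_zero (List.finRange r)
    ((Submodule.span ℝ (α '' {i | 0 < m i})).map x.equivFun.toLinearMap), smul_zero]
  · rintro ⟨β, hβ, h⟩
    rw [x.equivFun.injective h] at hβ
    exact hε.notMem_span x hm hβ
  · exact fun j hj => absurd (List.mem_finRange j) hj
  · rw [frac_eq, ← Finset.prod_inv_distrib]
    refine mul_mem (algebraMap_mem_polarAlg _ _) (prod_mem fun i _ => ?_)
    by_cases hi : 0 < m i
    · rw [← inv_pow, formRat_apply]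
      refine pow_mem (linRat_inv_mem_polarAlg (a := x.equivFun (α i)) (Set.mem_ofPred.mpr
        ⟨⟨α i, Submodule.subset_span ⟨i, hi, rfl⟩, rfl⟩, ?_,
        fun j hj => absurd (List.mem_finRange j) hj⟩)) _
      simpa using hα i
    · rw [Nat.eq_zero_of_not_pos hi, pow_zero, inv_one]
      exact one_mem _

theorem repr_eq_apply {x : Module.Basis (Fin r) ℝ (Module.Dual ℝ V)} {ξ : V}
    (hx : IsAdapted x ξ) (β : Module.Dual ℝ V) (k : Fin r) (hk : (k : ℕ) = 0) :
    x.equivFun β k = β ξ := by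
  conv_rhs => rw [← x.sum_equivFun β]
  rw [LinearMap.sum_apply, Finset.sum_eq_single k]
  · rw [LinearMap.smul_apply, hx k, if_pos hk, smul_eq_mul, mul_one]
  · intro j _ hj
    rw [LinearMap.smul_apply, hx j, if_neg (fun h => hj (Fin.ext (h.trans hk.symm))), smul_zero]
  · simp

/-- The leading coordinate of each form is its value at `ξ`, hence positive. All weights are
therefore indicators of positive coefficients, and their product is the indicator of the cone. -/
theorem jkResLin_basis (hε : IsRegular α ε) {x : Module.Basis (Fin r) ℝ (Module.Dual ℝ V)} {ξ : V}
    (hx : IsAdapted x ξ) (hξ : ∀ i, 0 < α i ξ) {s : Fin r → Fin n}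
    (hs : IsBasisFamily fun k => α (s k)) :
    jkResLin B y x ε (1 / ∏ k, algebraMap (Poly r) (RatFun r) (linForm y (α (s k)))) =
      constExpRat (jkValue B α ε s) := by
  classical
  obtain ⟨c, hc0, hc, hcone⟩ := hε.exists_coeff x hs
  set β : Matrix (Fin r) (Fin r) ℝ := Matrix.of fun k => x.equivFun (α (s k)) with hβ
  have hdet : β.det ≠ 0 := by
    have h1 : LinearIndependent ℝ β.row :=
      hs.1.map' x.equivFun.toLinearMap (LinearEquiv.ker _)
    exact ((Matrix.isUnit_iff_isUnit_det _).mp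
      (Matrix.linearIndependent_rows_iff_isUnit.mp h1)).ne_zero
  have h1 : changeRat y x (1 / ∏ k, algebraMap (Poly r) (RatFun r) (linForm y (α (s k)))) =
      ∏ k, (linRat (β k))⁻¹ := by
    rw [one_div, map_inv₀, map_prod, Finset.prod_inv_distrib]
    simp only [changeRat_algebraMap, changeCoord_linForm]
    rfl
  have h2 : x.equivFun ε = ∑ k, c k • β k := by
    rw [hc, map_sum]
    simp only [map_smul]
    rfl
  rw [jkResLin_apply, h1, h2, resFold_basis (List.finRange r) (List.pairwise_lt_finRange r)
    Finset.univ β (fun i _ j hj => absurd (List.mem_finRange j) hj)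
    (fun i hi => absurd (Finset.mem_univ i) hi) hdet c (fun i _ => hc0 i), smul_constExpRat]
  congr 1
  have h3 : ∏ k, lexWeight (β k) (c k) = if ε ∈ cone α (Set.range s) then 1 else 0 := by
    have h4 : ∀ k, lexWeight (β k) (c k) = if 0 < c k then 1 else 0 := by
      intro k
      have hr : 0 < r := k.pos
      refine lexWeight_of_pos (lexPos_of_apply_pos (k := ⟨0, hr⟩) (fun j hj => ?_) ?_) _
      · exact absurd hj (Nat.not_lt_zero _)
      · change 0 < x.equivFun (α (s k)) ⟨0, hr⟩
        rw [repr_eq_apply hx _ _ rfl]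
        exact hξ _
    simp only [h4, hcone, Finset.prod_ite_zero, Finset.prod_const_one, Finset.mem_univ,
      true_implies]
  rw [h3, jkValue, gramDet_eq_det_sq_mul B x fun k => α (s k), Real.sqrt_mul (sq_nonneg _),
    Real.sqrt_sq_eq_abs]
  split_ifs
  · rw [mul_one, one_div, one_div, mul_inv, mul_comm]
  · rw [mul_zero, mul_zero]

end Functional

/-! ### Homogeneous components of rational functions -/

section Dilation

variable {r : ℕ}

/-- The dilation `P(x) ↦ P(T x)`. -/
def dilation (r : ℕ) : Poly r →+* LaurentSeries (RatFun r) :=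
  MvPolynomial.eval₂Hom (HahnSeries.C.comp (algebraMap ℝ (RatFun r))) fun j =>
    HahnSeries.single 1 (algebraMap (Poly r) (RatFun r) (MvPolynomial.X j))

theorem algebraMap_C (c : ℝ) :
    algebraMap (Poly r) (RatFun r) (MvPolynomial.C c) = algebraMap ℝ (RatFun r) c :=
  (IsScalarTower.algebraMap_apply ℝ (Poly r) (RatFun r) c).symm

theorem dilation_C (c : ℝ) : dilation r (MvPolynomial.C c) =
    HahnSeries.single 0 (algebraMap ℝ (RatFun r) c) :=
  MvPolynomial.eval₂Hom_C _ _ _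

theorem dilation_monomial (e : Fin r →₀ ℕ) : dilation r (MvPolynomial.monomial e 1) =
    HahnSeries.single (e.degree : ℤ)
      (algebraMap (Poly r) (RatFun r) (MvPolynomial.monomial e 1)) := by
  induction e using Finsupp.induction_linear with
  | zero =>
    rw [map_zero, ← MvPolynomial.C_apply, map_one, map_one, map_one, Nat.cast_zero]
    rfl
  | add e e' h h' =>
    have hm : (MvPolynomial.monomial (e + e') (1 : ℝ) : Poly r) =
        MvPolynomial.monomial e 1 * MvPolynomial.monomial e' 1 := by
      rw [MvPolynomial.monomial_mul, one_mul]
    rw [hm, map_mul, map_mul, h, h', HahnSeries.single_mul_single, map_add, Nat.cast_add]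
  | single j k =>
    have hm : (MvPolynomial.monomial (Finsupp.single j k) (1 : ℝ) : Poly r) =
        MvPolynomial.X j ^ k := by
      rw [MvPolynomial.X_pow_eq_monomial]
    rw [hm, map_pow, map_pow, dilation, MvPolynomial.eval₂Hom_X', HahnSeries.single_pow,
      Finsupp.degree_single]
    simp

theorem dilation_of_isHomogeneous {P : Poly r} {p : ℕ} (hP : P.IsHomogeneous p) :
    dilation r P = HahnSeries.single (p : ℤ) (algebraMap (Poly r) (RatFun r) P) := by
  have h1 : ∀ e ∈ P.support, dilation r (MvPolynomial.monomial e (P.coeff e)) =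
      HahnSeries.single (p : ℤ)
        (algebraMap (Poly r) (RatFun r) (MvPolynomial.monomial e (P.coeff e))) := by
    intro e he
    have hd : e.degree = p := by
      rw [Finsupp.degree_eq_weight_one]
      exact hP (MvPolynomial.mem_support_iff.mp he)
    have h2 : (MvPolynomial.monomial e (P.coeff e) : Poly r) =
        MvPolynomial.C (P.coeff e) * MvPolynomial.monomial e 1 := by
      rw [MvPolynomial.C_mul_monomial, mul_one]
    rw [h2, map_mul, dilation_C, dilation_monomial, hd, HahnSeries.single_mul_single, zero_add,
      map_mul (algebraMap (Poly r) (RatFun r)), algebraMap_C]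
  conv_lhs => rw [P.as_sum, map_sum, Finset.sum_congr rfl h1]
  conv_rhs => rw [P.as_sum, map_sum]
  exact (map_sum (HahnSeries.single.addMonoidHom (p : ℤ)) _ _).symm

theorem coeff_dilation (P : Poly r) (d : ℤ) : ∃ Q : Poly r,
    (dilation r P).coeff d = algebraMap (Poly r) (RatFun r) Q ∧
      ∀ p : ℕ, d = p → Q = MvPolynomial.homogeneousComponent p P := by
  have h1 : dilation r P = ∑ p ∈ Finset.range (P.totalDegree + 1), HahnSeries.single (p : ℤ)
      (algebraMap (Poly r) (RatFun r) (MvPolynomial.homogeneousComponent p P)) := by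
    conv_lhs => rw [← MvPolynomial.sum_homogeneousComponent P, map_sum]
    exact Finset.sum_congr rfl fun p _ =>
      dilation_of_isHomogeneous (MvPolynomial.homogeneousComponent_isHomogeneous p P)
  refine ⟨∑ p ∈ Finset.range (P.totalDegree + 1),
    if d = p then MvPolynomial.homogeneousComponent p P else 0, ?_, ?_⟩
  · rw [h1, HahnSeries.coeff_sum, map_sum]
    refine Finset.sum_congr rfl fun p _ => ?_
    rw [HahnSeries.coeff_single]
    split_ifs <;> simp
  · rintro p rfl
    simp only [Nat.cast_inj, Finset.sum_ite_eq, Finset.mem_range]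
    split_ifs with h
    · rfl
    · exact (MvPolynomial.homogeneousComponent_eq_zero p P (by omega)).symm

theorem dilation_injective : Function.Injective (dilation r) := by
  rw [injective_iff_map_eq_zero]
  intro P hP
  rw [← MvPolynomial.sum_homogeneousComponent P]
  refine Finset.sum_eq_zero fun p _ => ?_
  obtain ⟨Q, hQ, hQp⟩ := coeff_dilation P p
  rw [← hQp p rfl]
  apply IsFractionRing.injective (Poly r) (RatFun r)
  rw [← hQ, hP, map_zero, HahnSeries.coeff_zero]

/-- The dilation `f(x) ↦ f(T x)` of rational functions. -/
def dilationRat (r : ℕ) : RatFun r →+* LaurentSeries (RatFun r) :=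
  IsFractionRing.lift (K := RatFun r) (g := dilation r) dilation_injective

theorem dilationRat_algebraMap (P : Poly r) :
    dilationRat r (algebraMap (Poly r) (RatFun r) P) = dilation r P :=
  IsFractionRing.lift_algebraMap dilation_injective P

/-- The homogeneous component of degree `d` of a rational function. -/
def homProj (d : ℤ) : RatFun r →ₗ[ℝ] RatFun r where
  toFun f := (dilationRat r f).coeff d
  map_add' f g := by rw [map_add, HahnSeries.coeff_add]
  map_smul' c f := by
    rw [RingHom.id_apply, Algebra.smul_def, Algebra.smul_def, map_mul, ← algebraMap_C,
      dilationRat_algebraMap, dilation_C, algebraMap_C, HahnSeries.coeff_single_zero_mul]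

theorem homProj_apply (d : ℤ) (f : RatFun r) : homProj d f = (dilationRat r f).coeff d := rfl

theorem prod_single_pow {ι : Type*} (s : Finset ι) (a : ι → RatFun r) (m : ι → ℕ) :
    ∏ i ∈ s, (HahnSeries.single (1 : ℤ) (a i)) ^ m i =
      HahnSeries.single ((∑ i ∈ s, m i : ℕ) : ℤ) (∏ i ∈ s, a i ^ m i) := by
  classical
  induction s using Finset.induction_on with
  | empty => simp
  | insert i s hi ih =>
    rw [Finset.prod_insert hi, Finset.prod_insert hi, Finset.sum_insert hi, ih,
      HahnSeries.single_pow, HahnSeries.single_mul_single]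
    simp

variable {V : Type*} [AddCommGroup V] [Module ℝ V] {n : ℕ}
  {y : Module.Basis (Fin r) ℝ (Module.Dual ℝ V)} {α : Fin n → Module.Dual ℝ V}

/-- The denominator is homogeneous of degree `∑ m i`, so projecting only selects a component of the
numerator. -/
theorem homProj_frac (P : Poly r) (m : Fin n → ℕ) (d : ℤ) :
    homProj d (frac y α P m) = (dilation r P).coeff (d + (∑ i, m i : ℕ)) *
      (∏ i, formRat y (α i) ^ m i)⁻¹ := by
  have h1 : ∀ i, dilationRat r (formRat y (α i)) = HahnSeries.single 1 (formRat y (α i)) := by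
    intro i
    rw [← algebraMap_linForm, dilationRat_algebraMap,
      dilation_of_isHomogeneous (isHomogeneous_linForm y (α i)), Nat.cast_one]
  rw [homProj_apply, frac_eq, map_mul, dilationRat_algebraMap, map_inv₀, map_prod]
  simp only [map_pow, h1]
  rw [prod_single_pow, HahnSeries.inv_single]
  have h2 := HahnSeries.coeff_mul_single_add (r := (∏ i, formRat y (α i) ^ m i)⁻¹)
    (x := dilation r P) (a := d + (∑ i, m i : ℕ)) (b := -((∑ i, m i : ℕ) : ℤ))
  rwa [add_neg_cancel_right] at h2

theorem homProj_mem_nonGenPart (d : ℤ) {f : RatFun r} (hf : f ∈ nonGenPart y α) :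
    homProj d f ∈ nonGenPart y α := by
  suffices H : nonGenPart y α ≤ (nonGenPart y α).comap (homProj d) from H hf
  refine Submodule.span_le.mpr ?_
  rintro _ ⟨P, m, hm, rfl⟩
  obtain ⟨Q, hQ, -⟩ := coeff_dilation P (d + (∑ i, m i : ℕ))
  rw [SetLike.mem_coe, Submodule.mem_comap, homProj_frac, hQ, ← frac_eq]
  exact Submodule.subset_span ⟨Q, m, hm, rfl⟩

theorem homProj_frac_one (m : Fin n → ℕ) (d : ℤ) :
    homProj d (frac y α 1 m) = if d + (∑ i, m i : ℕ) = 0 then frac y α 1 m else 0 := by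
  rw [homProj_frac, map_one, ← HahnSeries.single_zero_one, HahnSeries.coeff_single]
  split_ifs
  · rw [frac_eq, map_one]
  · rw [zero_mul]

end Dilation

/-! ### Existence of `JK_ε` and its computation by iterated residues -/

section Existence

variable {V : Type*} [AddCommGroup V] [Module ℝ V] {n r : ℕ}
  {B : LinearMap.BilinForm ℝ (Module.Dual ℝ V)}
  {y : Module.Basis (Fin r) ℝ (Module.Dual ℝ V)} {α : Fin n → Module.Dual ℝ V}
  {ε : Module.Dual ℝ V}

theorem exists_isAdapted [FiniteDimensional ℝ V] (y : Module.Basis (Fin r) ℝ (Module.Dual ℝ V))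
    (ξ : V) (hξ : 0 < r → ξ ≠ 0) :
    ∃ x : Module.Basis (Fin r) ℝ (Module.Dual ℝ V), IsAdapted x ξ := by
  classical
  rcases Nat.eq_zero_or_pos r with hr | hr
  · subst hr
    exact ⟨y, fun k => k.elim0⟩
  have hfin : Module.finrank ℝ V = r := by
    rw [← Subspace.dual_finrank_eq, Module.finrank_eq_card_basis y, Fintype.card_fin]
  have hli : LinearIndepOn ℝ id ({ξ} : Set V) := LinearIndepOn.singleton (v := id) (hξ hr)
  let b := Module.Basis.extend hli
  have : Fintype (hli.extend (Set.subset_univ _)) := FiniteDimensional.fintypeBasisIndex b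
  have hcard : Fintype.card (hli.extend (Set.subset_univ _)) = Fintype.card (Fin r) := by
    rw [← Module.finrank_eq_card_basis b, hfin, Fintype.card_fin]
  let e := Fintype.equivOfCardEq hcard
  let i₀ : hli.extend (Set.subset_univ _) := ⟨ξ, hli.subset_extend _ rfl⟩
  let b' := b.reindex (e.trans (Equiv.swap (e i₀) ⟨0, hr⟩))
  have hb' : b' ⟨0, hr⟩ = ξ := by
    rw [Module.Basis.reindex_apply]
    simp only [Equiv.symm_trans_apply, Equiv.symm_swap, Equiv.swap_apply_right,
      Equiv.symm_apply_apply]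
    exact Module.Basis.extend_apply_self hli i₀
  refine ⟨b'.dualBasis, fun k => ?_⟩
  rw [← hb', Module.Basis.dualBasis_apply_self]
  simp only [Fin.ext_iff, eq_comm]

/-- The prescribed values are compatible with the linear relations among fractions because one
globally defined linear map, the iterated residue, realises them all. -/
theorem exists_isJKFunctional [FiniteDimensional ℝ V] (hα : ∀ i, α i ≠ 0) (hε : IsRegular α ε)
    {ξ : V} (hξ : ∀ i, 0 < α i ξ) (hn : 0 < r → 0 < n) :
    ∃ L : ratSpace y α →ₗ[ℝ] ℝ, IsJKFunctional B y α ε L := by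
  obtain ⟨x, hx⟩ := exists_isAdapted y ξ (by
    rintro hr rfl
    simpa using hξ ⟨0, hn hr⟩)
  -- `ρ` is any linear retraction of the rational functions onto the constants; it only turns
  -- constant rational functions into real numbers.
  obtain ⟨ρ, hρ⟩ := LinearMap.exists_leftInverse_of_injective (Algebra.linearMap ℝ (RatFun r))
    (LinearMap.ker_eq_bot.mpr (algebraMap ℝ (RatFun r)).injective)
  -- The projection to degree `-r` is needed: on generating fractions of lower degree the residue of
  -- `f e^ε` picks up Taylor coefficients of `e^ε` and need not vanish.
  let Φ : RatFun r →ₗ[ℝ] ℝ :=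
    ρ ∘ₗ Finsupp.lapply 0 ∘ₗ jkResLin B y x ε ∘ₗ homProj (-(r : ℤ))
  have hΦ : ∀ f, Φ f = ρ ((jkResLin B y x ε (homProj (-(r : ℤ)) f)) 0) := fun _ => rfl
  refine ⟨Φ ∘ₗ (ratSpace y α).subtype, ⟨?_, ?_, ?_⟩⟩
  · intro f hf
    change Φ f = 0
    rw [hΦ, jkResLin_eq_zero hα hε x (homProj_mem_nonGenPart _ hf), Finsupp.zero_apply, map_zero]
  · intro d hd f hf
    change Φ f = 0
    have hle : genPart y α d ≤ LinearMap.ker (homProj (r := r) (-(r : ℤ))) := by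
      refine Submodule.span_le.mpr ?_
      rintro _ ⟨m, -, hm, rfl⟩
      rw [SetLike.mem_coe, LinearMap.mem_ker, homProj_frac_one, hm, if_neg]
      omega
    rw [hΦ, LinearMap.mem_ker.mp (hle hf), LinearMap.map_zero, Finsupp.zero_apply, map_zero]
  · intro s hs f hf
    change Φ f = jkValue B α ε s
    let m : Fin n → ℕ := fun i => if i ∈ Set.range s then 1 else 0
    have hm : {i | 0 < m i} = Set.range s := by
      ext i
      by_cases hi : i ∈ Set.range s
      · exact ⟨fun _ => hi, fun _ => by simp only [m, if_pos hi, Set.mem_ofPred_eq, zero_lt_one]⟩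
      · have hmi : m i = 0 := if_neg hi
        exact ⟨fun h => absurd (h : 0 < m i) hmi.not_gt, fun h => absurd h hi⟩
    have hsum : ∑ i, m i = r := by
      classical
      have h1 : ∑ i ∈ Finset.univ.image s, m i = r := by
        rw [Finset.sum_image hs.injective.injOn]
        simp [m]
      refine Eq.trans ?_ h1
      refine (Finset.sum_subset (Finset.subset_univ _) fun i _ hi => ?_).symm
      refine if_neg fun h => hi ?_
      obtain ⟨k, rfl⟩ := h
      exact Finset.mem_image_of_mem s (Finset.mem_univ k)
    have hfm := frac_eq_of_basisSupport (y := y) (α := α) hs.injective hm hsum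
    have hproj : homProj (-(r : ℤ)) (f : RatFun r) = f := by
      rw [hf, ← hfm, homProj_frac_one, hsum, if_pos (neg_add_cancel _)]
    rw [hΦ, hproj, hf, jkResLin_basis hε hx hξ hs, constExpRat, Finsupp.single_eq_same]
    exact DFunLike.congr_fun hρ (jkValue B α ε s)

/-- Every functional `JK_ε` is computed by the iterated residue. -/
theorem IsJKFunctional.jkRes_eq {L : ratSpace y α →ₗ[ℝ] ℝ} (hL : IsJKFunctional B y α ε L)
    (hα : ∀ i, α i ≠ 0) (hε : IsRegular α ε) (hr : r ≤ n) {ξ : V} (hξ : ∀ i, 0 < α i ξ)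
    {x : Module.Basis (Fin r) ℝ (Module.Dual ℝ V)} (hx : IsAdapted x ξ) {P : Poly r}
    (hP : P.IsHomogeneous (n - r)) :
    JKRes B y x α ε P = constExpRat (L (simpleFrac y α P)) := by
  let Ψ : ratSpace y α →ₗ[ℝ] ExpRat r :=
    Finsupp.lsingle 0 ∘ₗ Algebra.linearMap ℝ (RatFun r) ∘ₗ L
  have hΨ : ∀ f, Ψ f = constExpRat (L f) := fun _ => rfl
  rw [JKRes_eq, ← hΨ]
  have hmem := frac_homogeneous_mem y hα Set.univ hP (m := fun _ => 1) (Set.subset_univ _) rfl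
  refine eq_on_sup_span (jkResLin B y x ε ∘ₗ (ratSpace y α).subtype) Ψ nonGenPart_le_ratSpace ?_
    (fun f hf => ?_) ?_ (simpleFrac y α P) hmem
  · rintro f ⟨m, -, -, -, rfl⟩
    exact frac_mem_ratSpace y α 1 m
  · rw [hΨ, hL.nonGen f hf, LinearMap.comp_apply, Submodule.subtype_apply,
      jkResLin_eq_zero hα hε x hf, constExpRat, map_zero, Finsupp.single_zero]
  · rintro f ⟨m, ⟨s, hs, hm⟩, -, hsum, hf⟩
    -- The total degree is `(n - r) - n = -r`, so only simple fractions over bases occur.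
    have hsum' : ∑ i, m i = r := by
      simp only [Finset.sum_const, Finset.card_univ, Fintype.card_fin, smul_eq_mul, mul_one] at hsum
      omega
    have hfm := frac_eq_of_basisSupport (y := y) (α := α) hs.injective hm hsum'
    rw [hΨ, hL.apply_frac hs hm f hf, if_pos hsum', LinearMap.comp_apply, Submodule.subtype_apply,
      hf, hfm, jkResLin_basis hε hx hξ hs]

end Existence

/-! ### The quotient by the ideal in degree `n - r` is at most a line -/

section IdealTheory

variable {V : Type*} [AddCommGroup V] [Module ℝ V] {n r : ℕ}
  {B : LinearMap.BilinForm ℝ (Module.Dual ℝ V)}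
  {y : Module.Basis (Fin r) ℝ (Module.Dual ℝ V)} {α : Fin n → Module.Dual ℝ V}
  {ε : Module.Dual ℝ V}

/-! ### Bases contained in the arrangement -/

theorem cone_subset_span (S : Set (Fin n)) :
    cone α S ⊆ (Submodule.span ℝ (α '' S) : Set (Module.Dual ℝ V)) :=
  Submodule.span_le_restrictScalars ℝ≥0 ℝ (α '' S)

theorem IsRegular.isGenerating (hε : IsRegular α ε)
    (y : Module.Basis (Fin r) ℝ (Module.Dual ℝ V)) {S : Set (Fin n)} (h : ε ∈ cone α S) :
    IsGenerating α S := by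
  by_contra hS
  exact hε.notMem_span y hS (cone_subset_span S h)

theorem isBasisFamily_of_card_eq (y : Module.Basis (Fin r) ℝ (Module.Dual ℝ V))
    {S : Finset (Fin n)} (hcard : S.card = r) (hS : IsGenerating α S) :
    IsBasisFamily fun i : S => α i := by
  have h1 : Submodule.span ℝ (Set.range fun i : S => α i) = ⊤ := by
    rw [← hS, Set.image_eq_range]
    rfl
  refine ⟨linearIndependent_of_top_le_span_of_card_eq_finrank h1.ge ?_, h1⟩
  rw [Fintype.card_coe, hcard, Module.finrank_eq_card_basis y, Fintype.card_fin]

theorem IsBasisFamily.card_eq (y : Module.Basis (Fin r) ℝ (Module.Dual ℝ V))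
    {S : Finset (Fin n)} (hS : IsBasisFamily fun i : S => α i) : S.card = r := by
  obtain ⟨e, -⟩ := exists_of_basis_finset y S hS
  simpa using (Fintype.card_congr e).symm

theorem IsBasisFamily.exists_coords {S : Finset (Fin n)} (hS : IsBasisFamily fun i : S => α i)
    (β : Module.Dual ℝ V) : ∃ c : Fin n → ℝ, β = ∑ i ∈ S, c i • α i := by
  classical
  have hmem : β ∈ Submodule.span ℝ (Set.range fun i : S => α i) := hS.2 ▸ Submodule.mem_top
  obtain ⟨c, hc⟩ := (Submodule.mem_span_range_iff_exists_fun ℝ).mp hmem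
  refine ⟨fun i => if hi : i ∈ S then c ⟨i, hi⟩ else 0, ?_⟩
  rw [← hc, ← Finset.sum_coe_sort S]
  refine Finset.sum_congr rfl fun i _ => ?_
  simp only [dif_pos i.2]

theorem IsBasisFamily.exists_functional {S : Finset (Fin n)}
    (hS : IsBasisFamily fun i : S => α i) (f : Fin n → ℝ) :
    ∃ φ : Module.Dual ℝ V →ₗ[ℝ] ℝ, ∀ i ∈ S, φ (α i) = f i := by
  let b := Module.Basis.mk hS.1 hS.2.ge
  refine ⟨b.constr ℝ fun i => f i, fun i hi => ?_⟩
  have hb : b ⟨i, hi⟩ = α i := Module.Basis.mk_apply _ _ _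
  rw [← hb, Module.Basis.constr_basis]

/-- Strict positivity is the non-degeneracy condition of the simplex method below. -/
theorem IsRegular.pos_of_mem_cone (hε : IsRegular α ε)
    (y : Module.Basis (Fin r) ℝ (Module.Dual ℝ V)) {S : Finset (Fin n)}
    (hS : IsBasisFamily fun i : S => α i) (h : ε ∈ cone α (S : Set (Fin n))) {c : Fin n → ℝ}
    (hc : ε = ∑ i ∈ S, c i • α i) : ∀ i ∈ S, 0 < c i := by
  obtain ⟨d, -, hd, hcone⟩ := hε.exists_coeff y (s := fun i : S => (i : Fin n)) hS
  have hrange : Set.range (fun i : S => (i : Fin n)) = (S : Set (Fin n)) := Subtype.range_coe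
  rw [hrange] at hcone
  have hpos := hcone.mp h
  intro i hi
  rw [← Finset.sum_coe_sort S] at hc
  have h2 : ∀ k : S, c k - d k = 0 := Fintype.linearIndependent_iff.mp hS.1 _ (by
    simp only [sub_smul, Finset.sum_sub_distrib]
    rw [← hc, ← hd, sub_self])
  rw [sub_eq_zero.mp (h2 ⟨i, hi⟩)]
  exact hpos _

/-! ### The ideal in degree `n - r` -/

variable (y α) in
/-- The product of the `α i`, `i ∉ S`. -/
def coProd (S : Finset (Fin n)) : Poly r := ∏ i ∈ Sᶜ, linForm y (α i)

theorem coProd_mem_jkIdeal {S : Finset (Fin n)} (h : ε ∉ cone α (S : Set (Fin n))) :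
    coProd y α S ∈ jkIdeal y α ε := by
  refine Ideal.subset_span ⟨Sᶜ, ?_, rfl⟩
  have h2 : {i | i ∉ Sᶜ} = (S : Set (Fin n)) := by ext; simp
  rwa [h2]

theorem linForm_mul_coProd {S : Finset (Fin n)} {i : Fin n} (hi : i ∈ S) :
    linForm y (α i) * coProd y α S = coProd y α (S.erase i) := by
  rw [coProd, coProd, Finset.compl_erase, Finset.prod_insert (by simpa using hi)]

variable (y) in
theorem linForm_sum {ι : Type*} (s : Finset ι) (c : ι → ℝ) (β : ι → Module.Dual ℝ V) :
    linForm y (∑ i ∈ s, c i • β i) = ∑ i ∈ s, c i • linForm y (β i) := by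
  apply IsFractionRing.injective (Poly r) (RatFun r)
  rw [algebraMap_linForm, map_sum, map_sum]
  refine Finset.sum_congr rfl fun i _ => ?_
  rw [map_smul, MvPolynomial.smul_eq_C_mul, map_mul, algebraMap_C, algebraMap_linForm,
    Algebra.smul_def]

variable (y α ε) in
/-- The ideal and the products `∏_{i ∉ S} α_i` for the bases `S` with `ε` in their cone. -/
def feasibleSpan : Submodule ℝ (Poly r) :=
  (jkIdeal y α ε).restrictScalars ℝ ⊔ Submodule.span ℝ {q | ∃ S : Finset (Fin n),
    (IsBasisFamily fun i : S => α i) ∧ ε ∈ cone α (S : Set (Fin n)) ∧ q = coProd y α S}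

/-- If `ε` is outside the cone of `S`, the product is in the ideal. Otherwise `S` spans, and
expanding one variable in the `α i`, `i ∈ S`, trades a degree of the monomial for an element of `S`.
When the degree is used up, `S` is a spanning set of `r` elements, that is, a basis. -/
theorem monomial_mul_coProd_mem (hε : IsRegular α ε) (p : ℕ) :
    ∀ (e : Fin r →₀ ℕ), e.degree = p → ∀ S : Finset (Fin n), S.card = p + r →
      MvPolynomial.monomial e 1 * coProd y α S ∈ feasibleSpan y α ε := by
  induction p with
  | zero =>
    intro e he S hS
    rw [Finsupp.degree_eq_zero_iff] at he
    rw [he, ← MvPolynomial.C_apply, map_one, one_mul]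
    by_cases hcone : ε ∈ cone α (S : Set (Fin n))
    · exact Submodule.mem_sup_right (Submodule.subset_span ⟨S,
        isBasisFamily_of_card_eq y (by omega) (hε.isGenerating y hcone), hcone, rfl⟩)
    · exact Submodule.mem_sup_left (coProd_mem_jkIdeal hcone)
  | succ p ih =>
    intro e he S hS
    by_cases hcone : ε ∈ cone α (S : Set (Fin n))
    swap
    · exact Submodule.mem_sup_left (Ideal.mul_mem_left _ _ (coProd_mem_jkIdeal hcone))
    have hgen := hε.isGenerating y hcone
    obtain ⟨k, hk⟩ : ∃ k, e k ≠ 0 := by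
      by_contra! h
      rw [show e = 0 from Finsupp.ext h] at he
      simp at he
    obtain ⟨e', rfl⟩ : ∃ e', e = Finsupp.single k 1 + e' :=
      ⟨e - Finsupp.single k 1, (add_tsub_cancel_of_le
        (Finsupp.single_le_iff.mpr (Nat.one_le_iff_ne_zero.mpr hk))).symm⟩
    have he' : e'.degree = p := by
      rw [map_add, Finsupp.degree_single] at he
      omega
    have hyk : y k ∈ Submodule.span ℝ (Set.range fun i : S => α i) := by
      have : Submodule.span ℝ (Set.range fun i : S => α i) = ⊤ := by
        rw [← hgen, Set.image_eq_range]
        rfl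
      rw [this]
      exact Submodule.mem_top
    obtain ⟨c, hc⟩ := (Submodule.mem_span_range_iff_exists_fun ℝ).mp hyk
    rw [MvPolynomial.monomial_single_add, pow_one, ← linForm_basis y k, ← hc, linForm_sum,
      Finset.sum_mul, Finset.sum_mul]
    refine Submodule.sum_mem _ fun i _ => ?_
    rw [smul_mul_assoc, smul_mul_assoc, mul_right_comm, linForm_mul_coProd i.2, mul_comm]
    refine Submodule.smul_mem _ _ (ih e' he' _ ?_)
    rw [Finset.card_erase_of_mem i.2]
    omega

theorem isHomogeneous_mem_feasibleSpan (hε : IsRegular α ε) (hr : r ≤ n) {P : Poly r}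
    (hP : P.IsHomogeneous (n - r)) : P ∈ feasibleSpan y α ε := by
  rw [P.as_sum]
  refine Submodule.sum_mem _ fun e he => ?_
  rw [← mul_one (P.coeff e), ← smul_eq_mul, ← MvPolynomial.smul_monomial]
  refine Submodule.smul_mem _ _ ?_
  -- For `S` the full index set the product over the complement is `1`.
  have h := monomial_mul_coProd_mem (y := y) hε (n - r) e (by
    rw [Finsupp.degree_eq_weight_one]
    exact hP (MvPolynomial.mem_support_iff.mp he)) Finset.univ (by
      rw [Finset.card_univ, Fintype.card_fin]
      omega)
  simpa [coProd] using h

/-- Multiply the expansion of `α j` by the product of the forms outside `S` and `j`: each term is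
the product attached to an exchanged basis. -/
theorem coProd_eq_sum {S : Finset (Fin n)} {j : Fin n} (hj : j ∉ S) {a : Fin n → ℝ}
    (ha : α j = ∑ i ∈ S, a i • α i) :
    coProd y α S = ∑ i ∈ S, a i • coProd y α (insert j (S.erase i)) := by
  have h1 := linForm_mul_coProd (y := y) (α := α) (Finset.mem_insert_self j S)
  rw [Finset.erase_insert hj, ha, linForm_sum, Finset.sum_mul] at h1
  rw [← h1]
  refine Finset.sum_congr rfl fun i hi => ?_
  rw [smul_mul_assoc, linForm_mul_coProd (Finset.mem_insert_of_mem hi),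
    Finset.erase_insert_of_ne (by rintro rfl; exact hj hi)]

/-- Expanding `ε` in the basis obtained by exchanging `i` for `j`. -/
theorem exchange_sum {S : Finset (Fin n)} {i j : Fin n} (hi : i ∈ S) (hj : j ∉ S)
    {a t : Fin n → ℝ} (ha : α j = ∑ k ∈ S, a k • α k) (hai : a i ≠ 0)
    (ht : ε = ∑ k ∈ S, t k • α k) :
    ε = ∑ k ∈ insert j (S.erase i),
      (if k = j then t i / a i else t k - t i / a i * a k) • α k := by
  rw [Finset.sum_insert (fun h => hj (Finset.mem_of_mem_erase h)), if_pos rfl]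
  have h1 : ∑ k ∈ S.erase i, (if k = j then t i / a i else t k - t i / a i * a k) • α k =
      ∑ k ∈ S, (t k - t i / a i * a k) • α k := by
    rw [← Finset.add_sum_erase S _ hi, div_mul_cancel₀ _ hai, sub_self, zero_smul, zero_add]
    refine Finset.sum_congr rfl fun k hk => ?_
    rw [if_neg (by rintro rfl; exact hj (Finset.mem_of_mem_erase hk))]
  rw [h1]
  ext v
  have hav := LinearMap.congr_fun ha v
  have htv := LinearMap.congr_fun ht v
  simp only [LinearMap.sum_apply, LinearMap.smul_apply, smul_eq_mul, LinearMap.add_apply]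
    at hav htv ⊢
  simp only [sub_mul, mul_assoc, Finset.sum_sub_distrib, ← Finset.mul_sum]
  rw [← hav, ← htv]
  ring

theorem isBasisFamily_exchange (y : Module.Basis (Fin r) ℝ (Module.Dual ℝ V)) {S : Finset (Fin n)}
    (hS : IsBasisFamily fun i : S => α i) {i j : Fin n} (hi : i ∈ S) (hj : j ∉ S)
    {a : Fin n → ℝ} (ha : α j = ∑ k ∈ S, a k • α k) (hai : a i ≠ 0) :
    IsBasisFamily fun k : ((insert j (S.erase i) : Finset (Fin n))) => α k := by
  apply isBasisFamily_of_card_eq y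
  · rw [Finset.card_insert_of_notMem (fun h => hj (Finset.mem_of_mem_erase h)),
      Finset.card_erase_of_mem hi, ← hS.card_eq y]
    have := Finset.card_pos.mpr ⟨i, hi⟩
    omega
  · rw [IsGenerating, eq_top_iff, ← hS.2, Submodule.span_le]
    rintro _ ⟨k, rfl⟩
    have hmem : ∀ k ∈ insert j (S.erase i), α k ∈
        Submodule.span ℝ (α '' (insert j (S.erase i) : Finset (Fin n))) :=
      fun k hk => Submodule.subset_span ⟨k, hk, rfl⟩
    obtain ⟨k, hk⟩ := k
    -- Applied to `α k` itself, whose coordinates in `S` are an indicator, the exchange formula puts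
    -- `α k` in the span of the new family.
    have h2 := exchange_sum (ε := α k) hi hj ha hai (t := fun m => if m = k then 1 else 0)
      (by simp [hk])
    rw [SetLike.mem_coe]
    change α k ∈ _
    rw [h2]
    exact Submodule.sum_mem _ fun m hm => Submodule.smul_mem _ _ (hmem m hm)

open scoped Classical in
/-- Modulo the ideal, the products `∏_{i ∉ S} α_i` for the bases `S` with `ε` in their cone are
proportional. -/
theorem coProd_mem_sup_span (hε : IsRegular α ε) {J : Finset (Fin n)}
    (hJ : IsBasisFamily fun i : J => α i) (hεJ : ε ∈ cone α (J : Set (Fin n))) :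
    ∀ S : Finset (Fin n), (IsBasisFamily fun i : S => α i) → ε ∈ cone α (S : Set (Fin n)) →
      coProd y α S ∈ (jkIdeal y α ε).restrictScalars ℝ ⊔ Submodule.span ℝ {coProd y α J} := by
  -- The cost of a basis `S` is the total weight that the expansion of `ε` in `S` gives to vectors
  -- outside `J`; it is the value at `ε` of the functional `φ S`.
  have hφ : ∀ S : Finset (Fin n), (IsBasisFamily fun i : S => α i) →
      ∃ φ : Module.Dual ℝ V →ₗ[ℝ] ℝ, ∀ i ∈ S, φ (α i) = if i ∈ J then 0 else 1 :=
    fun S hS => hS.exists_functional _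
  choose φ hφ using hφ
  let cost : Finset (Fin n) → ℝ := fun S =>
    if hS : IsBasisFamily fun i : S => α i then φ S hS ε else 0
  have hcost : ∀ (S : Finset (Fin n)) (hS : IsBasisFamily fun i : S => α i), cost S = φ S hS ε :=
    fun S hS => dif_pos hS
  have hcost' : ∀ (S : Finset (Fin n)) (hS : IsBasisFamily fun i : S => α i) (c : Fin n → ℝ)
      (β : Module.Dual ℝ V), β = ∑ i ∈ S, c i • α i → φ S hS β = ∑ i ∈ S, if i ∈ J then 0 else c i := by
    intro S hS c β hc
    rw [hc, map_sum]
    refine Finset.sum_congr rfl fun i hi => ?_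
    rw [map_smul, hφ S hS i hi]
    split_ifs <;> simp
  -- There are finitely many subsets, so descent on the real-valued cost terminates.
  have hwf : WellFounded fun S T : Finset (Fin n) => cost S < cost T :=
    haveI : IsTrans (Finset (Fin n)) fun S T => cost S < cost T := ⟨fun _ _ _ => lt_trans⟩
    haveI : Std.Irrefl fun S T : Finset (Fin n) => cost S < cost T := ⟨fun _ => lt_irrefl _⟩
    Finite.wellFounded_of_trans_of_irrefl _
  intro S
  induction S using hwf.induction with
  | _ S ih =>
  intro hS hεS
  by_cases hSJ : S = J
  · rw [hSJ]
    exact Submodule.mem_sup_right (Submodule.mem_span_singleton_self _)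
  obtain ⟨t, ht⟩ := hS.exists_coords ε
  have htpos := hε.pos_of_mem_cone y hS hεS ht
  obtain ⟨t', ht'⟩ := hJ.exists_coords ε
  have htpos' := hε.pos_of_mem_cone y hJ hεJ ht'
  have hcpos : 0 < φ S hS ε := by
    rw [hcost' S hS t ε ht]
    obtain ⟨i, hi, hiJ⟩ : ∃ i ∈ S, i ∉ J := by
      by_contra! hsub
      exact hSJ (Finset.eq_of_subset_of_card_le hsub (by rw [hS.card_eq y, hJ.card_eq y]))
    refine Finset.sum_pos' (fun k hk => ?_) ⟨i, hi, ?_⟩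
    · split_ifs
      · exact le_rfl
      · exact (htpos k hk).le
    · rw [if_neg hiJ]
      exact htpos i hi
  -- Entering vector: `φ S` is positive at `ε`, which is a positive combination of the `α j`, `j ∈
  -- J`, so it is positive at one of these.
  obtain ⟨j, hjJ, hj⟩ : ∃ j ∈ J, 0 < φ S hS (α j) := by
    by_contra! hcon
    rw [ht', map_sum] at hcpos
    refine absurd hcpos (not_lt.mpr (Finset.sum_nonpos fun j hj => ?_))
    rw [map_smul, smul_eq_mul]
    exact mul_nonpos_of_nonneg_of_nonpos (htpos' j hj).le (hcon j hj)
  have hjS : j ∉ S := by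
    intro h
    rw [hφ S hS j h, if_pos hjJ] at hj
    exact lt_irrefl _ hj
  obtain ⟨a, ha⟩ := hS.exists_coords (α j)
  rw [coProd_eq_sum hjS ha]
  refine Submodule.sum_mem _ fun i hi => ?_
  by_cases hai : a i = 0
  · rw [hai, zero_smul]
    exact Submodule.zero_mem _
  refine Submodule.smul_mem _ _ ?_
  have hbasis := isBasisFamily_exchange y hS hi hjS ha hai
  have hexch := exchange_sum hi hjS ha hai ht
  -- All exchanges of `i` for `j` occur in the sum, so no leaving vector is chosen: the infeasible
  -- exchanges are in the ideal, and the feasible ones lower the cost.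
  by_cases hcone : ε ∈ cone α ((insert j (S.erase i) : Finset (Fin n)) : Set (Fin n))
  swap
  · exact Submodule.mem_sup_left (coProd_mem_jkIdeal hcone)
  have hpos := hε.pos_of_mem_cone y hbasis hcone hexch
  have hσ : 0 < t i / a i := by
    simpa using hpos j (Finset.mem_insert_self _ _)
  refine ih _ ?_ hbasis hcone
  rw [hcost _ hbasis, hcost _ hS, hcost' _ hbasis _ ε hexch, hcost' S hS t ε ht,
    Finset.sum_insert (fun h => hjS (Finset.mem_of_mem_erase h)), if_pos hjJ, zero_add]
  -- The new cost is `cost S - (t i / a i) * φ S (α j)`: the entering vector is in `J` and costs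
  -- nothing, and the term of `i` vanishes.
  have h1 : (∑ k ∈ S.erase i, if k ∈ J then 0 else
      if k = j then t i / a i else t k - t i / a i * a k) =
      ∑ k ∈ S, ((if k ∈ J then 0 else t k) - t i / a i * if k ∈ J then 0 else a k) := by
    rw [← Finset.add_sum_erase S _ hi]
    have h2 : ((if i ∈ J then 0 else t i) - t i / a i * if i ∈ J then 0 else a i) = 0 := by
      split_ifs
      · simp
      · rw [div_mul_cancel₀ _ hai, sub_self]
    rw [h2, zero_add]
    refine Finset.sum_congr rfl fun k hk => ?_
    rw [if_neg (c := k = j) (by rintro rfl; exact hjS (Finset.mem_of_mem_erase hk))]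
    split_ifs <;> simp
  rw [h1, Finset.sum_sub_distrib, ← Finset.mul_sum, ← hcost' S hS a _ ha]
  exact sub_lt_self _ (mul_pos hσ hj)

end IdealTheory

section NormalForms

variable {V : Type*} [AddCommGroup V] [Module ℝ V] {n r : ℕ}
  {B : LinearMap.BilinForm ℝ (Module.Dual ℝ V)}
  {y : Module.Basis (Fin r) ℝ (Module.Dual ℝ V)} {α : Fin n → Module.Dual ℝ V}
  {ε : Module.Dual ℝ V}

/-! ### `JK_ε` and the ideal -/

variable (y α) in
/-- `P ↦ P / ∏ α_i` as a linear map. -/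
def simpleFracLin : Poly r →ₗ[ℝ] ratSpace y α :=
  (fracLin y α fun _ => 1).codRestrict _ fun P => by
    rw [fracLin_apply]
    exact frac_mem_ratSpace y α P _

theorem simpleFracLin_apply (P : Poly r) : simpleFracLin y α P = simpleFrac y α P :=
  Subtype.ext (fracLin_apply y α P _)

/-- The exponents of `1 / ∏_{i ∉ K} α_i`. -/
def complExponent (K : Finset (Fin n)) : Fin n → ℕ := fun i => if i ∈ K then 0 else 1

theorem complExponent_pos_iff (K : Finset (Fin n)) (i : Fin n) :
    0 < complExponent K i ↔ i ∉ K := by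
  by_cases h : i ∈ K <;> simp [complExponent, h]

theorem coe_simpleFrac_mul_prod (hα : ∀ i, α i ≠ 0) (R : Poly r) (K : Finset (Fin n)) :
    (simpleFrac y α (R * ∏ j ∈ K, linForm y (α j)) : RatFun r) =
      frac y α R (complExponent K) := by
  have h0 : ∀ i, formRat y (α i) ≠ 0 := fun i => formRat_ne_zero y (hα i)
  have h1 : ∏ i, formRat y (α i) ^ complExponent K i = ∏ i ∈ Kᶜ, formRat y (α i) := by
    rw [← Finset.prod_mul_prod_compl K, Finset.prod_eq_one fun i hi => ?_, one_mul]
    · refine Finset.prod_congr rfl fun i hi => ?_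
      rw [complExponent, if_neg (Finset.mem_compl.mp hi), pow_one]
    · rw [complExponent, if_pos hi, pow_zero]
  change frac y α _ _ = _
  rw [frac_eq, frac_eq, h1, map_mul, map_prod]
  simp only [pow_one, algebraMap_linForm]
  have hK : ∏ i ∈ K, formRat y (α i) ≠ 0 := Finset.prod_ne_zero_iff.mpr fun i _ => h0 i
  rw [← Finset.prod_mul_prod_compl K fun i => formRat y (α i), mul_inv, mul_assoc,
    mul_inv_cancel_left₀ hK]

theorem IsJKFunctional.apply_simpleFrac_of_mem {L : ratSpace y α →ₗ[ℝ] ℝ}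
    (hL : IsJKFunctional B y α ε L) (hα : ∀ i, α i ≠ 0) {q : Poly r}
    (hq : q ∈ jkIdeal y α ε) : L (simpleFrac y α q) = 0 := by
  -- Multiplication by an arbitrary `R` is built in so that the induction passes through multiples
  -- in the ideal.
  suffices H : ∀ R : Poly r, L (simpleFrac y α (R * q)) = 0 by simpa using H 1
  rw [jkIdeal] at hq
  induction hq using Submodule.span_induction with
  | mem q hq =>
    obtain ⟨K, hK, rfl⟩ := hq
    intro R
    have hS : {i | 0 < complExponent K i} ⊆ {i | i ∉ K} := fun i hi =>
      (complExponent_pos_iff K i).mp hi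
    refine eq_on_sup_span L 0 nonGenPart_le_ratSpace ?_ (fun f hf => ?_) ?_ _
      ((coe_simpleFrac_mul_prod hα R K).symm ▸ frac_mem_span y hα {i | i ∉ K} R hS)
    · rintro f ⟨m, -, -, rfl⟩
      exact frac_mem_ratSpace y α 1 m
    · rw [hL.nonGen f hf, LinearMap.zero_apply]
    -- The partial fractions of `R / ∏_{i ∉ K} α_i` use only bases disjoint from `K`, whose cones
    -- miss `ε`.
    · rintro f ⟨m, ⟨s, hs, hm⟩, hmK, hf⟩
      rw [hL.apply_frac hs hm f hf, LinearMap.zero_apply, jkValue,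
        if_neg (fun hcone => hK (cone_mono (hm ▸ hmK) hcone)), ite_self]
  | zero => intro R; rw [mul_zero, ← simpleFracLin_apply, map_zero, map_zero]
  | add p q _ _ hp hq =>
    intro R
    have hp := hp R
    have hq := hq R
    rw [← simpleFracLin_apply] at hp hq ⊢
    rw [mul_add, map_add, map_add, hp, hq, add_zero]
  | smul a q _ hq =>
    intro R
    rw [smul_eq_mul, ← mul_assoc]
    exact hq _

theorem gramDet_comp_equiv {ι κ : Type*} [Fintype ι] [DecidableEq ι] [Fintype κ] [DecidableEq κ]
    (B : LinearMap.BilinForm ℝ (Module.Dual ℝ V)) (β : κ → Module.Dual ℝ V) (e : ι ≃ κ) :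
    gramDet B (fun i => β (e i)) = gramDet B β :=
  Matrix.det_submatrix_equiv_self e (Matrix.of fun i j => B (β i) (β j))

theorem IsJKFunctional.apply_coProd {L : ratSpace y α →ₗ[ℝ] ℝ}
    (hL : IsJKFunctional B y α ε L) (hα : ∀ i, α i ≠ 0) {J : Finset (Fin n)}
    (hJ : IsBasisFamily fun j : J => α j) (hεJ : ε ∈ cone α (J : Set (Fin n))) :
    L (simpleFrac y α (coProd y α J)) = 1 / Real.sqrt (gramDet B fun j : J => α j) := by
  obtain ⟨e, he⟩ := exists_of_basis_finset y J hJ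
  have hrange : Set.range (fun k => (e k : Fin n)) = (J : Set (Fin n)) :=
    (e.surjective.range_comp (fun i : J => (i : Fin n))).trans Subtype.range_coe
  have hm : {i | 0 < complExponent Jᶜ i} = Set.range fun k => (e k : Fin n) := by
    rw [hrange]
    ext i
    rw [Set.mem_ofPred_eq, complExponent_pos_iff]
    simp
  have hsum : ∑ i, complExponent Jᶜ i = r := by
    simp only [complExponent, Finset.mem_compl, ite_not, Finset.sum_ite_mem, Finset.univ_inter,
      Finset.sum_const, smul_eq_mul, mul_one]
    exact hJ.card_eq y
  have hf := coe_simpleFrac_mul_prod (y := y) hα 1 Jᶜ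
  rw [one_mul] at hf
  rw [coProd, hL.apply_frac he hm _ hf, if_pos hsum, jkValue, hrange, if_pos hεJ,
    gramDet_comp_equiv B (fun j : J => α j) e]

/-! ### Normal forms -/

/-- By uniqueness it is enough that the scaled normal form is again one: scaling creates no new
monomials. -/
theorem normalForm_eq_smul (mo : MonomialOrder (Fin r)) (I : Ideal (Poly r)) {P Q : Poly r} {c : ℝ}
    (h : P - c • Q ∈ I) : normalForm mo I P = c • normalForm mo I Q := by
  obtain ⟨h1, h2⟩ := isNormalForm_normalForm mo I Q
  refine (existsUnique_isNormalForm mo I P).unique (isNormalForm_normalForm mo I P) ⟨?_, ?_⟩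
  · have h3 : P - c • normalForm mo I Q = (P - c • Q) + c • (Q - normalForm mo I Q) := by
      rw [smul_sub]
      abel
    rw [h3]
    refine I.add_mem h ?_
    rw [MvPolynomial.smul_eq_C_mul]
    exact I.mul_mem_left _ h1
  · exact fun a ha => h2 a (MvPolynomial.support_smul ha)

end NormalForms

end JeffreyKirwan

end

/-! ### Comparison of the residue, the functional and the normal forms -/

theorem mainTheorem2
    {V : Type*} [AddCommGroup V] [Module ℝ V] [FiniteDimensional ℝ V]
    [TopologicalSpace V] [IsTopologicalAddGroup V] [ContinuousSMul ℝ V] [T2Space V]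
    {n r : ℕ}
    -- a scalar product on the dual space
    (B : LinearMap.BilinForm ℝ (Module.Dual ℝ V)) (hB : IsScalarProduct B)
    -- coordinates identifying polynomial functions on `V` with polynomials, a monomial order
    (y : Module.Basis (Fin r) ℝ (Module.Dual ℝ V)) (mo : MonomialOrder (Fin r))
    (α : Fin n → Module.Dual ℝ V) (hα : ∀ i, α i ≠ 0)
    (Λ : Set V) (hΛ : IsComponent α Λ) (hpol : ∀ i, α i ∈ dualCone Λ)
    (ε : Module.Dual ℝ V) (hε : IsRegular α ε)
    (J : Finset (Fin n)) (hJ : IsBasisFamily fun j : J => α j)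
    (hεJ : ε ∈ cone α {j | j ∈ J}) :
    -- the functional `JK_ε` is well defined
    (∃! L : ratSpace y α →ₗ[ℝ] ℝ, IsJKFunctional B y α ε L) ∧
    normalForm mo (jkIdeal y α ε) (∏ i ∈ Jᶜ, linForm y (α i)) ≠ 0 ∧
    ∀ L : ratSpace y α →ₗ[ℝ] ℝ, IsJKFunctional B y α ε L →
      ∀ P : Poly r, P.IsHomogeneous (n - r) →
        (∀ ξ ∈ Λ, ∀ x : Module.Basis (Fin r) ℝ (Module.Dual ℝ V), IsAdapted x ξ →
          JKRes B y x α ε P = constExpRat (L (simpleFrac y α P))) ∧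
        algebraMap ℝ (RatFun r) (L (simpleFrac y α P)) =
          algebraMap ℝ (RatFun r) (1 / Real.sqrt (gramDet B fun j : J => α j)) *
            (algebraMap (Poly r) (RatFun r) (normalForm mo (jkIdeal y α ε) P) /
              algebraMap (Poly r) (RatFun r)
                (normalForm mo (jkIdeal y α ε) (∏ i ∈ Jᶜ, linForm y (α i)))) := by
  obtain ⟨ξ₀, hξ₀, hΛ⟩ := hΛ
  have hξΛ : ξ₀ ∈ Λ := hΛ ▸ mem_connectedComponentIn hξ₀
  have hcard : J.card = r := hJ.card_eq y
  have hrn : r ≤ n := by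
    rw [← hcard]
    simpa using J.card_le_univ
  have hpos : 0 < Real.sqrt (gramDet B fun j : J => α j) :=
    Real.sqrt_pos.mpr (gramDet_pos hB hJ.1)
  obtain ⟨L₀, hL₀⟩ := exists_isJKFunctional (B := B) (y := y) hα hε (ξ := ξ₀)
    (fun i => hpol i ξ₀ hξΛ) (fun h => lt_of_lt_of_le h hrn)
  -- A zero normal form would put the product in the ideal, which `L₀` kills, while its value there
  -- is a positive number.
  have hN : normalForm mo (jkIdeal y α ε) (coProd y α J) ≠ 0 := by
    intro h0
    have h1 := (isNormalForm_normalForm mo (jkIdeal y α ε) (coProd y α J)).1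
    rw [h0, sub_zero] at h1
    have h2 := hL₀.apply_simpleFrac_of_mem hα h1
    rw [hL₀.apply_coProd hα hJ hεJ] at h2
    exact (one_div_pos.mpr hpos).ne' h2
  refine ⟨⟨L₀, hL₀, fun L hL => hL.unique hα hL₀⟩, hN, fun L hL P hP => ⟨fun ξ hξ x hx =>
    hL.jkRes_eq hα hε hrn (fun i => hpol i ξ hξ) hx hP, ?_⟩⟩
  -- This yields `P ≡ c ∏_{i ∉ J} α_i` modulo the ideal; the same `c` is the ratio of the values of
  -- `L` and the ratio of the normal forms.
  have hle : feasibleSpan y α ε ≤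
      (jkIdeal y α ε).restrictScalars ℝ ⊔ Submodule.span ℝ {coProd y α J} := by
    refine sup_le le_sup_left (Submodule.span_le.mpr ?_)
    rintro _ ⟨S, hS, hεS, rfl⟩
    exact coProd_mem_sup_span hε hJ hεJ S hS hεS
  obtain ⟨q, hq, p, hp, hqp⟩ :=
    Submodule.mem_sup.mp (hle (isHomogeneous_mem_feasibleSpan hε hrn hP))
  obtain ⟨c, rfl⟩ := Submodule.mem_span_singleton.mp hp
  have hmem : P - c • coProd y α J ∈ jkIdeal y α ε := by
    rw [← hqp, add_sub_cancel_right]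
    exact hq
  have hLP : L (simpleFrac y α P) = c * (1 / Real.sqrt (gramDet B fun j : J => α j)) := by
    rw [← hL.apply_coProd hα hJ hεJ, ← hqp, ← simpleFracLin_apply, ← simpleFracLin_apply, map_add,
      map_add, map_smul, map_smul, simpleFracLin_apply q, hL.apply_simpleFrac_of_mem hα hq,
      zero_add, smul_eq_mul]
  have hN' : algebraMap (Poly r) (RatFun r)
      (normalForm mo (jkIdeal y α ε) (coProd y α J)) ≠ 0 := by
    rwa [Ne, map_eq_zero_iff _ (IsFractionRing.injective (Poly r) (RatFun r))]
  change _ = _ * (_ / algebraMap (Poly r) (RatFun r)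
    (normalForm mo (jkIdeal y α ε) (coProd y α J)))
  rw [normalForm_eq_smul mo _ hmem, MvPolynomial.smul_eq_C_mul, map_mul (algebraMap (Poly r) _),
    algebraMap_C, mul_div_assoc, div_self hN', mul_one, hLP, map_mul, mul_comm]
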